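/- Work over $\mathbb{C}$. For integers $d,m_0,n,m\ge 0$ and points $p_0,\dots,p_n\in\mathbb{P}^2$, consider the linear system of plane curves of degree $d$ having multiplicity at least $m_0$ at $p_0$ and at least $m$ at each of $p_1,\dots,p_n$; its dimension is the dimension of the corresponding vector space of forms of degree $d$, minus one (so it is $-1$ exactly when the system is empty). Let $\mathcal{L}(d,m_0,n,m)$ denote this system for general points $p_0,\dots,p_n$. Its dimension $\dim\mathcal{L}(d,m_0,n,m)$ is the minimum of these dimensions over all $(n+1)$-tuples of points of $\mathbb{P}^2$ (by semicontinuity, this is the value on a dense Zariski open set of tuples). Let $$v(d,m_0,n,m)=\frac{d(d+3)}2-\frac{m_0(m_0+1)}2-n\,\frac{m(m+1)}2$$ be its virtual dimension. Call $\mathcal{L}(d,m_0,n,m)$ *empty* if its dimension is $-1$, and *non-special* if $\dim\mathcal{L}(d,m_0,n,m)=\max\{-1,v(d,m_0,n,m)\}$. Fix $d,m_0,n,m$. (a) Suppose that there are integers $k,b$ with $0<k<d$ and $0<b<n$ such that 1. $\mathcal{L}(d-k-1,m_0,n-b,m)$ is empty, 2. $\mathcal{L}(d,d-k+1,b,m)$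 is empty, and 3. $\dim\mathcal{L}(d-k,m_0,n-b,m)+\dim\mathcal{L}(d,d-k,b,m)\le d-k-1$. Then $\mathcal{L}(d,m_0,n,m)$ is empty (and therefore non-special). Moreover, for any integers $0<k<d$ and $0<b<n$, condition 3 holds automatically if $v(d,m_0,n,m)\le -1$ and both systems occurring in condition 3 are non-special with virtual dimension at least $-1$. (b) Suppose that there are integers $k,b$ with $0<k<d$ and $0<b<n$ such that 1. $v(d-k,m_0,n-b,m)\ge -1$ and $\mathcal{L}(d-k,m_0,n-b,m)$ is non-special, 2. $v(d,d-k,b,m)\ge -1$ and $\mathcal{L}(d,d-k,b,m)$ is non-special, and 3. $\dim\mathcal{L}(d-k-1,m_0,n-b,m)+\dim\mathcal{L}(d,d-k+1,b,m)\le v(d,m_0,n,m)-1$. Then $\mathcal{L}(d,m_0,n,m)$ is non-special, with virtual dimension $v(d,m_0,n,m)\ge -1$; in particular $\dim\mathcal{L}(d,m_0,n,m)=v(d,m_0,n,m)$. Moreover, for any integers $0<k<d$ and $0<b<n$, condition 3 holds automatically if both systems occurring in condition 3 are non-special with virtual dimension at least $-1$. -/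

import Mathlib

open scoped LinearAlgebra.Projectivization

namespace PlaneSystem

/-- The complex projective plane. -/
abbrev Plane : Type := ℙ ℂ (Fin 3 → ℂ)

/-- Homogeneous coordinate ring of the plane. -/
abbrev Poly : Type := MvPolynomial (Fin 3) ℂ

/-- Taylor expansion of a polynomial at the vector `v`, that is `F(X) ↦ F(v + X)`. -/
noncomputable def taylorAt (v : Fin 3 → ℂ) : Poly →ₐ[ℂ] Poly :=
  MvPolynomial.aeval (fun i => MvPolynomial.C (v i) + MvPolynomial.X i)

/-- The Taylor expansion of `F` at `v` has no term of degree less than `m`; equivalently all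
partial derivatives of `F` of order less than `m` vanish at `v`. -/
def VanishesToOrder (F : Poly) (v : Fin 3 → ℂ) (m : ℕ) : Prop :=
  ∀ a : Fin 3 →₀ ℕ, a.degree < m → MvPolynomial.coeff a (taylorAt v F) = 0

/-- The plane curve with homogeneous equation `F` has multiplicity at least `m` at the point `p`.
By homogeneity the chosen representative is irrelevant, see `vanishesToOrder_smul`. -/
def HasMultiplicityAtLeast (F : Poly) (p : Plane) (m : ℕ) : Prop :=
  VanishesToOrder F p.rep m

/-- For a form `F`, the order of vanishing at a vector depends only on the line it spans. -/
theorem vanishesToOrder_smul {F : Poly} {d : ℕ} (hF : F.IsHomogeneous d) (v : Fin 3 → ℂ)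
    {c : ℂ} (hc : c ≠ 0) (m : ℕ) (h : VanishesToOrder F v m) : VanishesToOrder F (c • v) m := by
  have hscale : ∀ (G : Poly) (a : Fin 3 →₀ ℕ),
      MvPolynomial.coeff a (MvPolynomial.aeval
        (fun i => (MvPolynomial.C c * MvPolynomial.X i : Poly)) G)
        = c ^ a.degree * MvPolynomial.coeff a G := by
    intro G a
    induction G using MvPolynomial.induction_on' with
    | monomial u r =>
      have h1 : (MvPolynomial.aeval (fun i => (MvPolynomial.C c * MvPolynomial.X i : Poly)))
          (MvPolynomial.monomial u r) = MvPolynomial.C (c ^ u.degree)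
            * MvPolynomial.monomial u r := by
        rw [MvPolynomial.aeval_monomial, MvPolynomial.monomial_eq (s := u) (a := r)]
        simp only [Finsupp.prod, mul_pow, Finset.prod_mul_distrib, Finsupp.degree_apply,
          Finset.prod_pow_eq_pow_sum, map_pow, MvPolynomial.algebraMap_eq]
        ring
      rw [h1, MvPolynomial.coeff_C_mul, MvPolynomial.coeff_monomial]
      split_ifs with hu
      · rw [hu]
      · simp
    | add p q hp hq => simp only [map_add, MvPolynomial.coeff_add, hp, hq, mul_add]
  have hhom : MvPolynomial.aeval (fun i => (MvPolynomial.C c * MvPolynomial.X i : Poly)) F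
      = MvPolynomial.C (c ^ d) * F := by
    ext a
    rw [hscale, MvPolynomial.coeff_C_mul]
    by_cases ha : MvPolynomial.coeff a F = 0
    · simp [ha]
    · rw [← hF ha, Finsupp.degree_eq_weight_one]; rfl
  have hcomp : MvPolynomial.aeval (fun i => (MvPolynomial.C c * MvPolynomial.X i : Poly))
      (taylorAt (c • v) F) = taylorAt v
        (MvPolynomial.aeval (fun i => (MvPolynomial.C c * MvPolynomial.X i : Poly)) F) := by
    have hext : (MvPolynomial.aeval
          (fun i => (MvPolynomial.C c * MvPolynomial.X i : Poly))).comp (taylorAt (c • v))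
        = (taylorAt v).comp (MvPolynomial.aeval
          (fun i => (MvPolynomial.C c * MvPolynomial.X i : Poly))) := by
      apply MvPolynomial.algHom_ext
      intro i
      simp [taylorAt, mul_add, MvPolynomial.algHom_C, MvPolynomial.algebraMap_eq]
    exact DFunLike.congr_fun hext F
  intro a ha
  have h1 := hscale (taylorAt (c • v) F) a
  rw [hcomp, hhom] at h1
  have h2 : taylorAt v (MvPolynomial.C (c ^ d) * F) = MvPolynomial.C (c ^ d) * taylorAt v F := by
    simp [taylorAt, MvPolynomial.algHom_C, MvPolynomial.algebraMap_eq]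
  rw [h2, MvPolynomial.coeff_C_mul, h a ha, mul_zero] at h1
  rcases mul_eq_zero.mp h1.symm with h3 | h3
  · exact absurd h3 (pow_ne_zero _ hc)
  · exact h3

/-- The vector space of forms of degree `d` whose curve has multiplicity at least `μ i` at the
point `p i` for every `i`. The linear system of curves is its projectivization. -/
noncomputable def sections {ι : Type} (d : ℕ) (μ : ι → ℕ) (p : ι → Plane) : Submodule ℂ Poly where
  carrier := {F | F.IsHomogeneous d ∧ ∀ i, HasMultiplicityAtLeast F (p i) (μ i)}
  zero_mem' := ⟨MvPolynomial.isHomogeneous_zero _ _ _, fun i a _ => by simp⟩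
  add_mem' := fun {F G} hF hG => ⟨hF.1.add hG.1, fun i a ha => by
    rw [map_add, MvPolynomial.coeff_add, hF.2 i a ha, hG.2 i a ha, add_zero]⟩
  smul_mem' := fun c F hF => ⟨(MvPolynomial.homogeneousSubmodule (Fin 3) ℂ d).smul_mem c hF.1,
    fun i a ha => by rw [map_smul, MvPolynomial.coeff_smul, hF.2 i a ha, smul_zero]⟩

/-- Multiplicity `m₀` at the point `p 0` and multiplicity `m` at the `n` points `p 1, …, p n`. -/
def quasiHomMult (m₀ n m : ℕ) : Fin (n + 1) → ℕ := Fin.cons m₀ (fun _ => m)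

/-- The dimension `ℓ(d, m₀, n, m)` of the system `L(d, m₀, n, m)`: the minimum, over all
`(n + 1)`-tuples of points of the plane, of the projective dimension of the linear system based at
the tuple. By semicontinuity it is attained on a dense Zariski open set of tuples. -/
noncomputable def dim (d m₀ n m : ℕ) : ℤ :=
  ((⨅ p : Fin (n + 1) → Plane,
    Module.finrank ℂ (sections d (quasiHomMult m₀ n m) p) : ℕ) : ℤ) - 1

/-- The virtual dimension `v(d, m₀, n, m)`; all three divisions are exact. -/
def virtualDim (d m₀ n m : ℕ) : ℤ :=
  (d : ℤ) * (d + 3) / 2 - (m₀ : ℤ) * (m₀ + 1) / 2 - (n : ℤ) * (m * (m + 1) / 2)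

/-- The expected dimension `e(d, m₀, n, m)`. -/
def expectedDim (d m₀ n m : ℕ) : ℤ := max (-1) (virtualDim d m₀ n m)

/-- The system (based at general points) is empty. -/
def IsEmptySystem (d m₀ n m : ℕ) : Prop := dim d m₀ n m = -1

/-- The system (based at general points) is non-special. -/
def NonSpecial (d m₀ n m : ℕ) : Prop := dim d m₀ n m = expectedDim d m₀ n m

end PlaneSystem

open PlaneSystem

/-!
The plane is degenerated into two components by letting some of the base points come together.

Put `c = d - k`, let `p` stand for `n - b + 1` points carrying the multiplicities `m₀, m, …, m` and
`q` for `b` points of multiplicity `m`. The points `diag(t, t, 1) p` collapse to `(0 : 0 : 1)` as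
`t → 0`, while the points `q` stay fixed. Decompose a form of degree `d` according to the degree `j`
of its monomials in `X` and `Y`. Rescaling the part of degree `j < c` by a suitable power of `t`
turns the conditions at `diag(t, t, 1) p` and `q` into linear conditions that depend polynomially on
`t` (`gluedSections`, `finrank_vecSections_sumElim_le`). At `t = 0` they say that the part of
degrees `j ≥ c`, which is a form of degree `d` vanishing to order `c` at `(0 : 0 : 1)`, has the
prescribed multiplicities at `q`, and that the part of degrees `j ≤ c`, which is `Z ^ (d - c)` times
a form of degree `c`, has the prescribed multiplicities at `p`. So the limit is a fibre product of
`L(d, c, b, m)` and `L(c, m₀, n - b, m)` over the space of binary forms of degree `c`, and the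
kernels of the two projections to that space are `L(d, c + 1, b, m)` and `L(c - 1, m₀, n - b, m)`
(`finrank_gluedSections_zero_le`). The dimension of a common kernel is upper semicontinuous in the
parameter (`finite_setOf_finrank_lt`), hence the dimension of the limit bounds the dimension of
`L(d, m₀, n, m)`.

The dimension of the fibre product is known once the images in the binary forms are transverse.
Replacing `p` by a translate under `GL₂` moves one image by `GL₂`, and two spaces of binary forms
can always be made transverse in this way (`exists_isBinaryChange_finrank_inf_le`). Indeed, at a
general point of the line a `b`-dimensional space of polynomials contains no nonzero element
vanishing to order `b` (`finite_setOf_exists_pow_dvd`); placing such points at `0` for one space and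
at `∞` for the other, the one-parameter torus degenerates the first space to a span of monomials
that meets the second only in `0` (`exists_diagonal_disjoint`).

The resulting estimate `generalRank_le_max`, the lower bound `virtualDim_le_dim` and the relations
between the virtual dimensions of the systems involved give all the claims.
-/

namespace PlaneSystem

open MvPolynomial

/-! ### Semicontinuity of the dimension of a common kernel -/

/-- Linear conditions that depend polynomially on a parameter `s` cut out a space whose dimension
exceeds that at `s₀` for at most finitely many `s`: on a complement `U` of the kernel at `s₀`,
`dim U` of the conditions have a nonzero determinant at `s₀`, hence at all but finitely many `s`. -/
theorem finite_setOf_finrank_lt {V : Type*} [AddCommGroup V] [Module ℂ V] [FiniteDimensional ℂ V]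
    {I : Type*} (l : ℂ → I → V →ₗ[ℂ] ℂ)
    (hl : ∀ i x, ∃ P : Polynomial ℂ, ∀ s, l s i x = P.eval s)
    (K : ℂ → Submodule ℂ V) (hK : ∀ s x, x ∈ K s ↔ ∀ i, l s i x = 0) (s₀ : ℂ) :
    {s | Module.finrank ℂ (K s₀) < Module.finrank ℂ (K s)}.Finite := by
  classical
  obtain ⟨U, hU⟩ := Submodule.exists_isCompl (K s₀)
  let g : I → Module.Dual ℂ U := fun i => (l s₀ i).comp U.subtype
  have hsep : ∀ x : U, (∀ i, g i x = 0) → x = 0 := by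
    intro x hx
    have h1 : (x : V) ∈ K s₀ := (hK _ _).2 hx
    exact Subtype.ext ((Submodule.disjoint_def.1 hU.disjoint) _ h1 x.2)
  have hspan : Submodule.span ℂ (Set.range g) = ⊤ := by
    have h1 : (Submodule.span ℂ (Set.range g)).dualCoannihilator = ⊥ := by
      rw [eq_bot_iff]
      intro x hx
      rw [Submodule.mem_dualCoannihilator] at hx
      exact (Submodule.mem_bot ℂ).2 (hsep x fun i => hx _ (Submodule.subset_span ⟨i, rfl⟩))
    rw [← Subspace.dualCoannihilator_dualAnnihilator_eq
      (W := Submodule.span ℂ (Set.range g)), h1, Submodule.dualAnnihilator_bot]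
  obtain ⟨b, hb, hbspan, hbli⟩ := exists_linearIndependent ℂ (Set.range g)
  rw [hspan] at hbspan
  let B : Module.Basis b ℂ (Module.Dual ℂ U) := Module.Basis.mk hbli (by simp [hbspan])
  have : Fintype b := FiniteDimensional.fintypeBasisIndex B
  have hcard : Fintype.card b = Module.finrank ℂ U := by
    rw [← Module.finrank_eq_card_basis B, Subspace.dual_finrank_eq]
  let e : Module.Basis b ℂ U := (Module.finBasis ℂ U).reindex
    (Fintype.equivOfCardEq (by simp [hcard]))
  choose ix hix using fun β : b => hb β.2
  choose P hP using hl
  let D : Polynomial ℂ := (Matrix.of fun β j : b => P (ix β) (e j : V)).det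
  have hD : ∀ s, D.eval s = (Matrix.of fun β j : b => l s (ix β) (e j : V)).det := by
    intro s
    rw [← Polynomial.coe_evalRingHom, RingHom.map_det]
    congr 1
    ext β j
    simp [hP]
  have key : ∀ s (x : U), (Matrix.of fun β j : b => l s (ix β) (e j : V)).mulVec (e.repr x)
      = fun β => l s (ix β) (x : V) := by
    intro s x
    ext β
    have h1 : (x : V) = ∑ j, e.repr x j • (e j : V) := by
      have h2 := congrArg U.subtype (e.sum_repr x)
      rw [map_sum] at h2
      exact h2.symm
    rw [h1, map_sum]
    exact Finset.sum_congr rfl fun j _ => by rw [map_smul, smul_eq_mul, mul_comm]; rfl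
  have hD0 : D.eval s₀ ≠ 0 := by
    rw [hD]
    intro h0
    obtain ⟨v, hv, hv0⟩ := Matrix.exists_mulVec_eq_zero_iff.2 h0
    have h1 := key s₀ (e.equivFun.symm v)
    have h2 : ⇑(e.repr (e.equivFun.symm v)) = v := e.equivFun.apply_symm_apply v
    rw [h2, hv0] at h1
    have h3 : e.equivFun.symm v = 0 := by
      have : ∀ φ : Module.Dual ℂ U, φ (e.equivFun.symm v) = 0 := by
        intro φ
        have hφ : φ ∈ Submodule.span ℂ b := by rw [hbspan]; trivial
        induction hφ using Submodule.span_induction with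
        | mem x hx =>
          have := congrFun h1 ⟨x, hx⟩
          have h4 := hix ⟨x, hx⟩
          simp only at h4
          rw [← h4]
          exact this.symm
        | zero => rfl
        | add x y _ _ hx hy => rw [LinearMap.add_apply, hx, hy, add_zero]
        | smul a x _ hx => rw [LinearMap.smul_apply, hx, smul_zero]
      exact hsep _ fun i => this (g i)
    exact hv (e.equivFun.symm.map_eq_zero_iff.1 h3)
  have hDne : D ≠ 0 := by rintro h; simp [h] at hD0
  refine (D.roots.toFinset.finite_toSet).subset ?_
  intro s hs
  by_contra hsr
  have hDs : D.eval s ≠ 0 := by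
    intro h
    exact hsr (by simp [hDne, h])
  have hdisj : Disjoint (K s) U := by
    rw [Submodule.disjoint_def]
    intro x hx hxU
    have h1 := key s ⟨x, hxU⟩
    have h2 : (fun β => l s (ix β) x) = 0 := funext fun β => (hK s x).1 hx _
    rw [h2] at h1
    have h3 : (e.repr ⟨x, hxU⟩ : b → ℂ) = 0 := by
      by_contra hne
      exact hDs ((hD s).trans (Matrix.exists_mulVec_eq_zero_iff.1 ⟨_, hne, h1⟩))
    have h4 : (⟨x, hxU⟩ : U) = 0 := by
      apply e.repr.injective
      ext β
      simpa using congrFun h3 β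
    simpa using h4
  have h1 := Submodule.finrank_add_finrank_le_of_disjoint hdisj
  have h2 := Submodule.finrank_add_eq_of_isCompl hU
  have hs' : Module.finrank ℂ (K s₀) < Module.finrank ℂ (K s) := hs
  omega

/-- `finite_setOf_finrank_lt` for subspaces of a finite-dimensional subspace `W`. -/
theorem finite_setOf_finrank_lt_of_le {E : Type*} [AddCommGroup E] [Module ℂ E]
    (W : Submodule ℂ E) [FiniteDimensional ℂ W]
    {I : Type*} (l : ℂ → I → E →ₗ[ℂ] ℂ)
    (hl : ∀ i, ∀ x ∈ W, ∃ P : Polynomial ℂ, ∀ s, l s i x = P.eval s)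
    (K : ℂ → Submodule ℂ E) (hK : ∀ s x, x ∈ K s ↔ x ∈ W ∧ ∀ i, l s i x = 0) (s₀ : ℂ) :
    {s | Module.finrank ℂ (K s₀) < Module.finrank ℂ (K s)}.Finite := by
  have h := finite_setOf_finrank_lt (V := W) (fun s i => (l s i).comp W.subtype)
    (fun i x => hl i x x.2) (fun s => (K s).comap W.subtype) (by
      intro s x
      simp [hK]) s₀
  have hr : ∀ s, Module.finrank ℂ ((K s).comap W.subtype) = Module.finrank ℂ (K s) := fun s =>
    (Submodule.comapSubtypeEquivOfLe (fun x hx => ((hK s x).1 hx).1)).finrank_eq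
  simpa only [hr] using h

/-! ### Linear substitutions and coefficientwise scalings -/

/-- The linear change of coordinates `F(X) ↦ F(M X)`. -/
noncomputable def subst (M : Matrix (Fin 3) (Fin 3) ℂ) : Poly →ₐ[ℂ] Poly :=
  aeval (fun i => ∑ j, C (M i j) * X j)

theorem eval_subst (M : Matrix (Fin 3) (Fin 3) ℂ) (F : Poly) (v : Fin 3 → ℂ) :
    eval v (subst M F) = eval (M.mulVec v) F := by
  rw [subst, aeval_def, eval_eval₂]
  have h : ((eval v).comp (algebraMap ℂ Poly)) = RingHom.id ℂ := by ext x; simp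
  rw [h]
  simp only [eval, coe_eval₂Hom]
  congr 1
  ext i
  simp [Matrix.mulVec, dotProduct]

theorem subst_subst (M N : Matrix (Fin 3) (Fin 3) ℂ) (F : Poly) :
    subst M (subst N F) = subst (N * M) F := by
  refine MvPolynomial.funext fun v => ?_
  rw [eval_subst, eval_subst, eval_subst, Matrix.mulVec_mulVec]

theorem subst_one (F : Poly) : subst 1 F = F := by
  refine MvPolynomial.funext fun v => ?_
  rw [eval_subst, Matrix.one_mulVec]

theorem isHomogeneous_subst {F : Poly} {d : ℕ} (hF : F.IsHomogeneous d)
    (M : Matrix (Fin 3) (Fin 3) ℂ) : (subst M F).IsHomogeneous d := by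
  have := hF.aeval (fun i => ∑ j, C (M i j) * X j : Fin 3 → Poly) (n := 1) (fun i =>
    IsHomogeneous.sum _ _ _ fun j _ => isHomogeneous_C_mul_X _ _)
  rwa [one_mul] at this

/-- The linear operator multiplying the coefficient of the monomial with exponent `u` by `φ u`. -/
noncomputable def coeffScale (φ : (Fin 3 →₀ ℕ) → ℂ) : Poly →ₗ[ℂ] Poly :=
  (basisMonomials (Fin 3) ℂ).constr ℂ fun u => monomial u (φ u)

theorem coeffScale_monomial (φ : (Fin 3 →₀ ℕ) → ℂ) (u : Fin 3 →₀ ℕ) (r : ℂ) :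
    coeffScale φ (monomial u r) = monomial u (φ u * r) := by
  have h : monomial u r = r • basisMonomials (Fin 3) ℂ u := by
    simp [smul_monomial]
  rw [h, map_smul, coeffScale, Module.Basis.constr_basis, smul_monomial, smul_eq_mul, mul_comm]

@[simp]
theorem coeff_coeffScale (φ : (Fin 3 →₀ ℕ) → ℂ) (F : Poly) (u : Fin 3 →₀ ℕ) :
    coeff u (coeffScale φ F) = φ u * coeff u F := by
  classical
  induction F using MvPolynomial.induction_on' with
  | monomial a r =>
    rw [coeffScale_monomial, coeff_monomial, coeff_monomial]
    split_ifs with h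
    · rw [h]
    · simp
  | add p q hp hq => rw [map_add, coeff_add, hp, hq, coeff_add, mul_add]

theorem isHomogeneous_coeffScale {F : Poly} {d : ℕ} (hF : F.IsHomogeneous d)
    (φ : (Fin 3 →₀ ℕ) → ℂ) : (coeffScale φ F).IsHomogeneous d := by
  intro u hu
  rw [coeff_coeffScale] at hu
  exact hF (right_ne_zero_of_mul hu)

theorem subst_diagonal (t : Fin 3 → ℂ) (F : Poly) :
    subst (Matrix.diagonal t) F = coeffScale (fun u => ∏ i, t i ^ u i) F := by
  induction F using MvPolynomial.induction_on' with
  | monomial a r =>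
    refine MvPolynomial.funext fun v => ?_
    rw [eval_subst, coeffScale_monomial, eval_monomial, eval_monomial,
      Finsupp.prod_fintype _ _ (by simp), Finsupp.prod_fintype _ _ (by simp)]
    simp only [Matrix.mulVec_diagonal, mul_pow, Finset.prod_mul_distrib]
    ring
  | add p q hp hq => rw [map_add, hp, hq, map_add]

/-! ### Vanishing to a given order along lines -/

/-- The restriction `T ↦ F(v + T w)` of `F` to the line through `v` in direction `w`. -/
noncomputable def lineRestrict (v w : Fin 3 → ℂ) : Poly →ₐ[ℂ] Polynomial ℂ :=
  aeval (fun i => Polynomial.C (v i) + Polynomial.X * Polynomial.C (w i))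

theorem coeff_lineRestrict_zero (w : Fin 3 → ℂ) (G : Poly) (k : ℕ) :
    (aeval (fun i => Polynomial.X * Polynomial.C (w i)) G : Polynomial ℂ).coeff k
      = eval w (homogeneousComponent k G) := by
  induction G using MvPolynomial.induction_on' with
  | monomial a r =>
    have h1 : (aeval (fun i => Polynomial.X * Polynomial.C (w i)) (monomial a r) : Polynomial ℂ)
        = Polynomial.C (eval w (monomial a r)) * Polynomial.X ^ a.degree := by
      rw [aeval_monomial, eval_monomial, Finsupp.prod_fintype _ _ (by simp),
        Finsupp.prod_fintype _ _ (by simp), Finsupp.degree_eq_sum]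
      simp only [mul_pow, Finset.prod_mul_distrib, Finset.prod_pow_eq_pow_sum, map_mul, map_prod,
        map_pow, Polynomial.algebraMap_eq]
      ring
    rw [h1, Polynomial.coeff_C_mul_X_pow]
    split_ifs with h
    · rw [homogeneousComponent_of_mem (m := k) (isHomogeneous_monomial r rfl), if_pos h]
    · rw [homogeneousComponent_of_mem (m := k) (isHomogeneous_monomial r rfl), if_neg h, map_zero]
  | add p q hp hq => rw [map_add, Polynomial.coeff_add, hp, hq, map_add, map_add]

/-- A polynomial vanishes to order `m` at `v` if and only if its restriction to each line through
`v` does. -/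
theorem vanishesToOrder_iff_lineRestrict (F : Poly) (v : Fin 3 → ℂ) (m : ℕ) :
    VanishesToOrder F v m ↔ ∀ w, Polynomial.X ^ m ∣ lineRestrict v w F := by
  have h1 : ∀ w, lineRestrict v w F
      = aeval (fun i => Polynomial.X * Polynomial.C (w i)) (taylorAt v F) := by
    intro w
    have : lineRestrict v w = (aeval (fun i => (Polynomial.X * Polynomial.C (w i)
        : Polynomial ℂ))).comp (taylorAt v) := by
      apply algHom_ext
      intro i
      simp [lineRestrict, taylorAt, algHom_C]
    exact DFunLike.congr_fun this F
  simp only [Polynomial.X_pow_dvd_iff, h1, coeff_lineRestrict_zero]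
  constructor
  · intro h w k hk
    have : homogeneousComponent k (taylorAt v F) = 0 := by
      ext a
      rw [coeff_homogeneousComponent, coeff_zero]
      split_ifs with ha
      · exact h a (by omega)
      · rfl
    rw [this, map_zero]
  · intro h a ha
    have : homogeneousComponent a.degree (taylorAt v F) = 0 :=
      MvPolynomial.funext fun w => by rw [h w _ ha, map_zero]
    have h2 := coeff_homogeneousComponent (n := a.degree) (φ := taylorAt v F) a
    rw [this, if_pos rfl, coeff_zero] at h2
    exact h2.symm

theorem lineRestrict_subst (M : Matrix (Fin 3) (Fin 3) ℂ) (v w : Fin 3 → ℂ) (F : Poly) :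
    lineRestrict v w (subst M F) = lineRestrict (M.mulVec v) (M.mulVec w) F := by
  have : (lineRestrict v w).comp (subst M) = lineRestrict (M.mulVec v) (M.mulVec w) := by
    apply algHom_ext
    intro i
    simp only [lineRestrict, subst, AlgHom.comp_apply, aeval_X, map_sum, map_mul, algHom_C,
      Polynomial.algebraMap_eq, Matrix.mulVec, dotProduct, Finset.mul_sum,
      ← Finset.sum_add_distrib]
    exact Finset.sum_congr rfl fun j _ => by ring
  exact DFunLike.congr_fun this F

theorem vanishesToOrder_subst {M : Matrix (Fin 3) (Fin 3) ℂ} (hM : IsUnit M) (F : Poly)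
    (v : Fin 3 → ℂ) (m : ℕ) :
    VanishesToOrder (subst M F) v m ↔ VanishesToOrder F (M.mulVec v) m := by
  simp only [vanishesToOrder_iff_lineRestrict, lineRestrict_subst]
  refine ⟨fun h w => ?_, fun h w => h _⟩
  obtain ⟨w, rfl⟩ := (Matrix.mulVec_surjective_iff_isUnit.2 hM) w
  exact h w

/-- Multiplying by a power of the third coordinate does not affect the multiplicity at a point off
the line `Z = 0`. -/
theorem vanishesToOrder_X_pow_mul (F : Poly) {v : Fin 3 → ℂ} (hv : v 2 ≠ 0) (k m : ℕ) :
    VanishesToOrder (X 2 ^ k * F) v m ↔ VanishesToOrder F v m := by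
  simp only [vanishesToOrder_iff_lineRestrict]
  refine forall_congr' fun w => ?_
  rw [map_mul, map_pow]
  refine ⟨fun h => IsCoprime.dvd_of_dvd_mul_left ?_ h, fun h => h.mul_left _⟩
  refine IsCoprime.pow ?_
  rw [Polynomial.irreducible_X.coprime_iff_not_dvd, Polynomial.X_dvd_iff]
  simpa [lineRestrict] using hv

theorem _root_.MvPolynomial.IsHomogeneous.degree_eq {F : Poly} {d : ℕ} (hF : F.IsHomogeneous d)
    {u : Fin 3 →₀ ℕ} (hu : coeff u F ≠ 0) : u 0 + u 1 + u 2 = d := by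
  by_contra h
  refine hu (hF.coeff_eq_zero ?_)
  rwa [Finsupp.degree_eq_sum, Fin.sum_univ_three]

/-- The coefficients of `F(X, Y, 1)` are those of the form `F`. -/
theorem coeff_erase_taylorAt_origin {F : Poly} {d : ℕ} (hF : F.IsHomogeneous d)
    {u : Fin 3 →₀ ℕ} (hu : u 0 + u 1 + u 2 = d) :
    coeff (u.erase 2) (taylorAt (Pi.single 2 1) F) = coeff u F := by
  classical
  have hmono : ∀ (a : Fin 3 →₀ ℕ) (r : ℂ), a 0 + a 1 + a 2 = d →
      coeff (u.erase 2) (taylorAt (Pi.single 2 1) (monomial a r)) = coeff u (monomial a r) := by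
    intro a r ha
    obtain ⟨q, hq⟩ : (X 2 : Poly) ∣ (1 + X 2) ^ a 2 - 1 := by
      have h2 := sub_dvd_pow_sub_pow (1 + X 2 : Poly) 1 (a 2)
      rwa [add_sub_cancel_left, one_pow] at h2
    have h1 : taylorAt (Pi.single 2 1) (monomial a r)
        = monomial (a.erase 2) r + X 2 * (q * monomial (a.erase 2) r) := by
      have h2 : monomial (a.erase 2) r = C r * (X 0 ^ a 0 * X 1 ^ a 1 : Poly) := by
        rw [monomial_eq, Finsupp.prod_fintype _ _ (by simp), Fin.prod_univ_three]
        simp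
      rw [← mul_assoc, ← hq, taylorAt, aeval_monomial, Finsupp.prod_fintype _ _ (by simp),
        Fin.prod_univ_three, h2]
      simp
      ring
    rw [h1, coeff_add, coeff_X_mul', if_neg (by simp), add_zero, coeff_monomial, coeff_monomial]
    refine if_congr ⟨fun h => ?_, fun h => by rw [h]⟩ rfl rfl
    have h0 := DFunLike.congr_fun h 0
    have h1 := DFunLike.congr_fun h 1
    simp at h0 h1
    ext i
    fin_cases i
    · exact h0
    · exact h1
    · show a 2 = u 2
      omega
  conv_lhs => rw [← support_sum_monomial_coeff F]
  conv_rhs => rw [← support_sum_monomial_coeff F]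
  rw [map_sum, coeff_sum, coeff_sum]
  exact Finset.sum_congr rfl fun a ha =>
    hmono a _ (hF.degree_eq (mem_support_iff.1 ha))

/-- A form vanishes to order `c` at `(0, 0, 1)` if and only if each of its monomials has degree at
least `c` in the first two variables. -/
theorem vanishesToOrder_origin_iff {F : Poly} {d : ℕ} (hF : F.IsHomogeneous d) (c : ℕ) :
    VanishesToOrder F (Pi.single 2 1) c ↔ ∀ u, u 0 + u 1 < c → coeff u F = 0 := by
  constructor
  · intro h u hu
    by_contra hne
    have key := coeff_erase_taylorAt_origin hF (hF.degree_eq hne)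
    have h1 := h (u.erase 2) (by
      rw [Finsupp.degree_eq_sum, Fin.sum_univ_three]
      simpa using hu)
    rw [key] at h1
    exact hne h1
  · intro h
    rw [vanishesToOrder_iff_lineRestrict]
    intro w
    rw [lineRestrict, aeval_def, eval₂_eq]
    refine Finset.dvd_sum fun u hu => Dvd.dvd.mul_left ?_ _
    have hc : c ≤ u 0 + u 1 := by
      by_contra hlt
      exact (mem_support_iff.1 hu) (h u (by omega))
    refine (pow_dvd_pow _ hc).trans ?_
    rw [Finset.prod_subset (Finset.subset_univ u.support) (by
      intro i _ hi; rw [Finsupp.notMem_support_iff.1 hi, pow_zero]), Fin.prod_univ_three]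
    refine Dvd.intro (Polynomial.C (w 0) ^ u 0 * Polynomial.C (w 1) ^ u 1 *
      (1 + Polynomial.X * Polynomial.C (w 2)) ^ u 2) ?_
    simp
    ring

/-! ### Linear systems based at vectors -/

/-- The forms of degree `d` vanishing to order `μ i` at the vector `v i` for every `i`. -/
noncomputable def vecSections {ι : Type*} (d : ℕ) (μ : ι → ℕ) (v : ι → Fin 3 → ℂ) :
    Submodule ℂ Poly where
  carrier := {F | F.IsHomogeneous d ∧ ∀ i, VanishesToOrder F (v i) (μ i)}
  zero_mem' := ⟨isHomogeneous_zero _ _ _, fun i a _ => by simp⟩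
  add_mem' := fun {F G} hF hG => ⟨hF.1.add hG.1, fun i a ha => by
    rw [map_add, coeff_add, hF.2 i a ha, hG.2 i a ha, add_zero]⟩
  smul_mem' := fun c F hF => ⟨(homogeneousSubmodule (Fin 3) ℂ d).smul_mem c hF.1,
    fun i a ha => by rw [map_smul, coeff_smul, hF.2 i a ha, smul_zero]⟩

theorem mem_vecSections {ι : Type*} {d : ℕ} {μ : ι → ℕ} {v : ι → Fin 3 → ℂ} {F : Poly} :
    F ∈ vecSections d μ v ↔ F.IsHomogeneous d ∧ ∀ i, VanishesToOrder F (v i) (μ i) :=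
  Iff.rfl

instance finiteDimensional_homogeneousSubmodule (d : ℕ) :
    FiniteDimensional ℂ (homogeneousSubmodule (Fin 3) ℂ d) :=
  Module.Finite.iff_fg.2 (homogeneousSubmodule_fg (Fin 3) ℂ d)

theorem vecSections_le {ι : Type*} (d : ℕ) (μ : ι → ℕ) (v : ι → Fin 3 → ℂ) :
    vecSections d μ v ≤ homogeneousSubmodule (Fin 3) ℂ d := fun _ hF => hF.1

instance {ι : Type*} (d : ℕ) (μ : ι → ℕ) (v : ι → Fin 3 → ℂ) :
    FiniteDimensional ℂ (vecSections d μ v) :=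
  Submodule.finiteDimensional_of_le (vecSections_le d μ v)

theorem sections_mk {ι : Type} (d : ℕ) (μ : ι → ℕ) (v : ι → Fin 3 → ℂ) (hv : ∀ i, v i ≠ 0) :
    sections d μ (fun i => Projectivization.mk ℂ (v i) (hv i)) = vecSections d μ v := by
  ext F
  refine and_congr_right fun hF => forall_congr' fun i => ?_
  obtain ⟨a, ha⟩ := Projectivization.exists_smul_eq_mk_rep ℂ (v i) (hv i)
  unfold HasMultiplicityAtLeast
  rw [← ha]
  refine ⟨fun h => ?_, fun h => vanishesToOrder_smul hF _ a.ne_zero _ h⟩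
  have h1 := vanishesToOrder_smul hF _ (inv_ne_zero a.ne_zero) _ h
  rwa [Units.smul_def, smul_smul, inv_mul_cancel₀ a.ne_zero, one_smul] at h1

theorem subst_injective {M : Matrix (Fin 3) (Fin 3) ℂ} (hM : IsUnit M) :
    Function.Injective (subst M) := by
  refine Function.LeftInverse.injective (g := subst M⁻¹) fun F => ?_
  rw [subst_subst, Matrix.mul_nonsing_inv _ ((Matrix.isUnit_iff_isUnit_det M).1 hM), subst_one]

theorem subst_subst_inv {M : Matrix (Fin 3) (Fin 3) ℂ} (hM : IsUnit M) (F : Poly) :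
    subst M (subst M⁻¹ F) = F := by
  rw [subst_subst, Matrix.nonsing_inv_mul _ ((Matrix.isUnit_iff_isUnit_det M).1 hM), subst_one]

theorem finrank_map_of_injective {E E' : Type*} [AddCommGroup E] [Module ℂ E] [AddCommGroup E']
    [Module ℂ E'] (f : E →ₗ[ℂ] E') (hf : Function.Injective f) (S : Submodule ℂ E) :
    Module.finrank ℂ (S.map f) = Module.finrank ℂ S :=
  (Submodule.equivMapOfInjective f hf S).finrank_eq.symm

theorem subst_mem_vecSections {ι : Type*} {d : ℕ} {μ : ι → ℕ} {v : ι → Fin 3 → ℂ}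
    {M : Matrix (Fin 3) (Fin 3) ℂ} (hM : IsUnit M) {F : Poly} (hF : F.IsHomogeneous d) :
    subst M F ∈ vecSections d μ v ↔ F ∈ vecSections d μ (fun i => M.mulVec (v i)) := by
  simp only [mem_vecSections, vanishesToOrder_subst hM, hF,
    isHomogeneous_subst hF]

theorem finrank_vecSections_mulVec {ι : Type*} (d : ℕ) (μ : ι → ℕ) (v : ι → Fin 3 → ℂ)
    {M : Matrix (Fin 3) (Fin 3) ℂ} (hM : IsUnit M) :
    Module.finrank ℂ (vecSections d μ (fun i => M.mulVec (v i)))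
      = Module.finrank ℂ (vecSections d μ v) := by
  have h : (vecSections d μ fun i => M.mulVec (v i)).map (subst M).toLinearMap
      = vecSections d μ v := by
    ext F
    constructor
    · rintro ⟨G, hG, rfl⟩
      exact (subst_mem_vecSections hM hG.1).2 hG
    · intro hF
      have h1 := subst_subst_inv hM F
      refine ⟨subst M⁻¹ F, (subst_mem_vecSections hM (isHomogeneous_subst hF.1 _)).1 ?_, h1⟩
      rwa [h1]
  rw [← h, finrank_map_of_injective (subst M).toLinearMap (subst_injective hM)]

theorem exists_mulVec_eq {v w : Fin 3 → ℂ} (hv : v ≠ 0) (hw : w ≠ 0) :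
    ∃ M : Matrix (Fin 3) (Fin 3) ℂ, IsUnit M ∧ M.mulVec v = w := by
  obtain ⟨g, hg⟩ := Submodule.exists_linearEquiv_restrict_eq
    ((LinearEquiv.toSpanNonzeroSingleton ℂ _ v hv).symm ≪≫ₗ
      LinearEquiv.toSpanNonzeroSingleton ℂ _ w hw)
  refine ⟨LinearMap.toMatrix' g.toLinearMap, ?_, ?_⟩
  · rw [← Matrix.mulVec_surjective_iff_isUnit]
    intro y
    exact ⟨g.symm y, by rw [LinearMap.toMatrix'_mulVec]; simp⟩
  · rw [LinearMap.toMatrix'_mulVec]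
    have h1 := hg (LinearEquiv.toSpanNonzeroSingleton ℂ _ v hv 1)
    rw [LinearEquiv.trans_apply, LinearEquiv.symm_apply_apply] at h1
    simpa using h1.symm

/-! ### General position -/

open Filter AffineMap in
/-- The property `P` of a point of a vector space is *open along lines* if, on every line on which
it holds somewhere, it fails for at most finitely many parameters. Zariski open properties are of
this kind. -/
def OpenAlongLines {E : Type*} [AddCommGroup E] [Module ℂ E] (P : E → Prop) : Prop :=
  ∀ (v w : E) (s₀ : ℂ), P (lineMap v w s₀) → ∀ᶠ s : ℂ in cofinite, P (lineMap v w s)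

theorem OpenAlongLines.and {E : Type*} [AddCommGroup E] [Module ℂ E] {P Q : E → Prop}
    (hP : OpenAlongLines P) (hQ : OpenAlongLines Q) : OpenAlongLines (fun x => P x ∧ Q x) :=
  fun v w s₀ h => (hP v w s₀ h.1).and (hQ v w s₀ h.2)

/-- Two nonempty properties that are open along lines hold simultaneously somewhere. -/
theorem OpenAlongLines.exists_and {E : Type*} [AddCommGroup E] [Module ℂ E] {P Q : E → Prop}
    (hP : OpenAlongLines P) (hQ : OpenAlongLines Q) (hP' : ∃ x, P x) (hQ' : ∃ x, Q x) :
    ∃ x, P x ∧ Q x := by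
  obtain ⟨v, hv⟩ := hP'
  obtain ⟨w, hw⟩ := hQ'
  have h1 := hP v w 0 (by simpa using hv)
  have h2 := hQ v w 1 (by simpa using hw)
  obtain ⟨s, hs⟩ := (h1.and h2).exists
  exact ⟨_, hs⟩

theorem exists_polynomial_coeff_taylorAt_lineMap (F : Poly) (a : Fin 3 →₀ ℕ) (v w : Fin 3 → ℂ) :
    ∃ P : Polynomial ℂ, ∀ s, coeff a (taylorAt (AffineMap.lineMap v w s) F) = P.eval s := by
  refine ⟨coeff a (aeval (fun i => C (Polynomial.C (v i)
    + Polynomial.X * Polynomial.C (w i - v i)) + X i) F : MvPolynomial (Fin 3) (Polynomial ℂ)),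
    fun s => ?_⟩
  rw [← Polynomial.coe_evalRingHom, ← coeff_map]
  congr 1
  induction F using MvPolynomial.induction_on with
  | C r =>
    simp [taylorAt, algHom_C, MvPolynomial.algebraMap_eq, IsScalarTower.algebraMap_apply ℂ
      (Polynomial ℂ) (MvPolynomial (Fin 3) (Polynomial ℂ))]
  | add p q hp hq => simp only [map_add, hp, hq]
  | mul_X p i hp =>
    rw [map_mul, map_mul, map_mul, hp]
    congr 1
    simp [taylorAt, AffineMap.lineMap_apply]
    ring

/-- Upper semicontinuity of the dimension of a linear system in its base points. -/
theorem openAlongLines_finrank_vecSections_le {ι : Type*} (d : ℕ) (μ : ι → ℕ) (r : ℕ) :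
    OpenAlongLines (fun v : ι → Fin 3 → ℂ => Module.finrank ℂ (vecSections d μ v) ≤ r) := by
  intro v w s₀ h
  have := finite_setOf_finrank_lt_of_le (homogeneousSubmodule (Fin 3) ℂ d)
    (I := {x : ι × (Fin 3 →₀ ℕ) // x.2.degree < μ x.1})
    (fun s x => (lcoeff ℂ x.1.2).comp (taylorAt (AffineMap.lineMap v w s x.1.1)).toLinearMap)
    (by
      intro x F _
      obtain ⟨P, hP⟩ := exists_polynomial_coeff_taylorAt_lineMap F x.1.2 (v x.1.1) (w x.1.1)
      exact ⟨P, fun s => by rw [← hP]; simp [AffineMap.lineMap_apply]⟩)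
    (fun s => vecSections d μ (AffineMap.lineMap v w s)) (by
      intro s F
      rw [mem_vecSections]
      refine and_congr_right fun _ => ⟨fun h x => h _ _ x.2, fun h i a ha => h ⟨(i, a), ha⟩⟩) s₀
  refine this.subset fun s hs => ?_
  have hs' : ¬ Module.finrank ℂ (vecSections d μ (AffineMap.lineMap v w s)) ≤ r := hs
  exact h.trans_lt (not_le.1 hs')

theorem openAlongLines_forall_apply_ne_zero {ι : Type*} [Finite ι] (j : Fin 3) :
    OpenAlongLines (fun v : ι → Fin 3 → ℂ => ∀ i, v i j ≠ 0) := by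
  intro v w s₀ h
  rw [Filter.eventually_all]
  intro i
  let P : Polynomial ℂ := Polynomial.C (v i j) + Polynomial.X * Polynomial.C (w i j - v i j)
  have hP : ∀ s, (AffineMap.lineMap v w s : ι → Fin 3 → ℂ) i j = P.eval s := by
    intro s
    simp [P, AffineMap.lineMap_apply, add_comm]
  have hP0 : P ≠ 0 := by
    intro h0
    have := h i
    rw [hP, h0] at this
    simp at this
  refine (P.roots.toFinset.finite_toSet).subset fun s hs => ?_
  have hs' : ¬ (AffineMap.lineMap v w s : ι → Fin 3 → ℂ) i j ≠ 0 := hs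
  rw [hP, not_not] at hs'
  simpa [hP0] using hs'

/-- Two linear systems attain small dimensions at a common tuple of points off the line `Z = 0`. -/
theorem exists_vecSections_finrank_le {ι : Type*} [Finite ι] (d₁ d₂ : ℕ) (μ₁ μ₂ : ι → ℕ)
    (v₁ v₂ : ι → Fin 3 → ℂ) :
    ∃ v : ι → Fin 3 → ℂ, (∀ i, v i 2 ≠ 0) ∧
      Module.finrank ℂ (vecSections d₁ μ₁ v) ≤ Module.finrank ℂ (vecSections d₁ μ₁ v₁) ∧
      Module.finrank ℂ (vecSections d₂ μ₂ v) ≤ Module.finrank ℂ (vecSections d₂ μ₂ v₂) := by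
  have h1 := openAlongLines_finrank_vecSections_le d₁ μ₁
    (Module.finrank ℂ (vecSections d₁ μ₁ v₁))
  have h2 := openAlongLines_finrank_vecSections_le d₂ μ₂
    (Module.finrank ℂ (vecSections d₂ μ₂ v₂))
  exact (openAlongLines_forall_apply_ne_zero 2).exists_and (h1.and h2)
    ⟨fun _ _ => 1, fun _ => one_ne_zero⟩ (h1.exists_and h2 ⟨v₁, le_rfl⟩ ⟨v₂, le_rfl⟩)

/-- The vector space dimension of the linear system at general points; one more than `dim`. -/
noncomputable def generalRank (d m₀ n m : ℕ) : ℕ :=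
  ⨅ p : Fin (n + 1) → Plane, Module.finrank ℂ (sections d (quasiHomMult m₀ n m) p)

theorem dim_eq_generalRank_sub_one (d m₀ n m : ℕ) :
    PlaneSystem.dim d m₀ n m = (generalRank d m₀ n m : ℤ) - 1 := rfl

theorem generalRank_le (d m₀ n m : ℕ) (v : Fin (n + 1) → Fin 3 → ℂ) (hv : ∀ i, v i ≠ 0) :
    generalRank d m₀ n m ≤ Module.finrank ℂ (vecSections d (quasiHomMult m₀ n m) v) := by
  rw [← sections_mk d _ v hv]
  exact Nat.sInf_le ⟨_, rfl⟩

theorem exists_finrank_eq_generalRank (d m₀ n m : ℕ) :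
    ∃ v : Fin (n + 1) → Fin 3 → ℂ, (∀ i, v i ≠ 0) ∧
      Module.finrank ℂ (vecSections d (quasiHomMult m₀ n m) v) = generalRank d m₀ n m := by
  have hne : (Set.range fun p : Fin (n + 1) → Plane =>
      Module.finrank ℂ (sections d (quasiHomMult m₀ n m) p)).Nonempty :=
    ⟨_, fun _ => Projectivization.mk ℂ (fun _ => 1) (fun h => one_ne_zero (congrFun h 0)), rfl⟩
  obtain ⟨p, hp⟩ := Nat.sInf_mem hne
  exact ⟨fun i => (p i).rep, fun i => (p i).rep_nonzero, hp⟩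

/-- Two systems with the same number of base points have general dimension at a common tuple of
points off the line `Z = 0`. -/
theorem exists_finrank_eq_generalRank_and (d₁ d₂ m₁ m₂ n m : ℕ) :
    ∃ v : Fin (n + 1) → Fin 3 → ℂ, (∀ i, v i 2 ≠ 0) ∧
      Module.finrank ℂ (vecSections d₁ (quasiHomMult m₁ n m) v) = generalRank d₁ m₁ n m ∧
      Module.finrank ℂ (vecSections d₂ (quasiHomMult m₂ n m) v) = generalRank d₂ m₂ n m := by
  obtain ⟨v₁, -, h₁⟩ := exists_finrank_eq_generalRank d₁ m₁ n m
  obtain ⟨v₂, -, h₂⟩ := exists_finrank_eq_generalRank d₂ m₂ n m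
  obtain ⟨v, hv, hv₁, hv₂⟩ := exists_vecSections_finrank_le d₁ d₂ _ _ v₁ v₂
  have hv0 : ∀ i, v i ≠ 0 := fun i h => hv i (congrFun h 2)
  exact ⟨v, hv, le_antisymm (hv₁.trans h₁.le) (generalRank_le _ _ _ _ v hv0),
    le_antisymm (hv₂.trans h₂.le) (generalRank_le _ _ _ _ v hv0)⟩

/-! ### The expected dimension is a lower bound -/

/-- The exponents of the monomials of degree `d` whose degree in the first two variables is less
than `m` are indexed by `i ≤ k < m`, through `X ^ i Y ^ (k - i) Z ^ (d - k)`. -/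
noncomputable def planeExponent (d m : ℕ) (x : Σ k : Fin m, Fin (k + 1)) : Fin 3 →₀ ℕ :=
  Finsupp.equivFunOnFinite.symm ![x.2, x.1 - x.2, d - x.1]

theorem card_planeExponent_index (m : ℕ) :
    Fintype.card (Σ k : Fin m, Fin (k + 1)) * 2 = m * (m + 1) := by
  rw [Fintype.card_sigma]
  simp only [Fintype.card_fin]
  rw [Fin.sum_univ_eq_sum_range (fun k => k + 1) m]
  induction m with
  | zero => rfl
  | succ m ih => rw [Finset.sum_range_succ, add_mul, ih]; ring

theorem planeExponent_injective (d : ℕ) : Function.Injective (planeExponent d (d + 1)) := by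
  rintro ⟨⟨k, hk⟩, ⟨i, hi⟩⟩ ⟨⟨l, hl⟩, ⟨j, hj⟩⟩ h
  have h0 : i = j := DFunLike.congr_fun h 0
  have h2 : d - k = d - l := DFunLike.congr_fun h 2
  obtain rfl : k = l := by omega
  subst h0
  rfl

theorem le_two_mul_finrank_homogeneousSubmodule (d : ℕ) :
    (d + 1) * (d + 2) ≤ Module.finrank ℂ (homogeneousSubmodule (Fin 3) ℂ d) * 2 := by
  have hmem : ∀ x, monomial (planeExponent d (d + 1) x) (1 : ℂ)
      ∈ homogeneousSubmodule (Fin 3) ℂ d := by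
    rintro ⟨⟨k, hk⟩, ⟨i, hi⟩⟩
    refine isHomogeneous_monomial _ ?_
    rw [Finsupp.degree_eq_sum, Fin.sum_univ_three]
    show i + (k - i) + (d - k) = d
    simp only at hi
    omega
  have hli : LinearIndependent ℂ fun x => (⟨_, hmem x⟩ : homogeneousSubmodule (Fin 3) ℂ d) := by
    refine LinearIndependent.of_comp (homogeneousSubmodule (Fin 3) ℂ d).subtype ?_
    have h := (basisMonomials (Fin 3) ℂ).linearIndependent.comp _ (planeExponent_injective d)
    rw [coe_basisMonomials] at h
    exact h
  have h1 := hli.fintype_card_le_finrank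
  have h2 := card_planeExponent_index (d + 1)
  nlinarith

/-- A point of multiplicity `m` imposes at most `m (m + 1) / 2` linear conditions on forms of a
given degree: after moving the point to `(0, 0, 1)` these are the vanishing of the coefficients
with exponents `planeExponent d m`. -/
theorem le_two_mul_finrank_vecSections {ι : Type*} [Fintype ι] (d : ℕ) (μ : ι → ℕ)
    (v : ι → Fin 3 → ℂ) (hv : ∀ i, v i ≠ 0) :
    (d + 1) * (d + 2) ≤ Module.finrank ℂ (vecSections d μ v) * 2 + ∑ i, μ i * (μ i + 1) := by
  have he : (Pi.single 2 1 : Fin 3 → ℂ) ≠ 0 := by simp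
  choose M hM hMv using fun i => exists_mulVec_eq he (hv i)
  let L : homogeneousSubmodule (Fin 3) ℂ d →ₗ[ℂ] ((x : Σ i, Σ k : Fin (μ i), Fin (k + 1)) → ℂ) :=
    LinearMap.pi fun x => (lcoeff ℂ (planeExponent d (μ x.1) x.2)).comp
      ((subst (M x.1)).toLinearMap.comp (homogeneousSubmodule (Fin 3) ℂ d).subtype)
  have hker : (LinearMap.ker L).map (homogeneousSubmodule (Fin 3) ℂ d).subtype
      ≤ vecSections d μ v := by
    rintro _ ⟨⟨F, hF⟩, hFL, rfl⟩
    have hF' : F.IsHomogeneous d := hF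
    refine ⟨hF', fun i => ?_⟩
    have hG := isHomogeneous_subst hF' (M i)
    rw [← hMv i, ← vanishesToOrder_subst (hM i)]
    refine (vanishesToOrder_origin_iff hG _).2 fun u hu => ?_
    by_contra hne
    have hdeg := hG.degree_eq hne
    have h1 : coeff (planeExponent d (μ i) ⟨⟨u 0 + u 1, hu⟩, ⟨u 0, by simp⟩⟩)
        (subst (M i) F) = 0 :=
      congrFun (LinearMap.mem_ker.1 hFL) ⟨i, ⟨⟨u 0 + u 1, hu⟩, ⟨u 0, by simp⟩⟩⟩
    have h2 : planeExponent d (μ i) ⟨⟨u 0 + u 1, hu⟩, ⟨u 0, by simp⟩⟩ = u := by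
      ext j
      fin_cases j
      · rfl
      · show u 0 + u 1 - u 0 = u 1
        omega
      · show d - (u 0 + u 1) = u 2
        omega
    rw [h2] at h1
    exact hne h1
  have h1 : Module.finrank ℂ (LinearMap.ker L) ≤ Module.finrank ℂ (vecSections d μ v) := by
    rw [← finrank_map_of_injective _ (Submodule.subtype_injective _) (LinearMap.ker L)]
    exact Submodule.finrank_mono hker
  have h2 := L.finrank_range_add_finrank_ker
  have h3 := (LinearMap.range L).finrank_le
  rw [Module.finrank_fintype_fun_eq_card, Fintype.card_sigma] at h3
  have h4 : (∑ i, Fintype.card (Σ k : Fin (μ i), Fin (k + 1))) * 2 = ∑ i, μ i * (μ i + 1) := by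
    rw [Finset.sum_mul]
    exact Finset.sum_congr rfl fun i _ => card_planeExponent_index _
  have h5 := le_two_mul_finrank_homogeneousSubmodule d
  omega

theorem two_mul_virtualDim (d m₀ n m : ℕ) :
    2 * virtualDim d m₀ n m = (d : ℤ) * (d + 3) - m₀ * (m₀ + 1) - n * (m * (m + 1)) := by
  have h1 : (2 : ℤ) ∣ (d : ℤ) * (d + 3) := by
    have := (Int.even_mul_succ_self d).two_dvd
    have h : (d : ℤ) * (d + 3) = d * (d + 1) + 2 * d := by ring
    rw [h]
    exact dvd_add this (dvd_mul_right _ _)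
  have h2 := Int.mul_ediv_cancel' (Int.even_mul_succ_self m₀).two_dvd
  have h3 := Int.mul_ediv_cancel' (Int.even_mul_succ_self m).two_dvd
  have h4 := Int.mul_ediv_cancel' h1
  unfold virtualDim
  linear_combination h4 - h2 - (n : ℤ) * h3

/-- The virtual dimension counts the conditions imposed by the base points, so it is a lower bound
for the dimension. -/
theorem virtualDim_le_dim (d m₀ n m : ℕ) : virtualDim d m₀ n m ≤ PlaneSystem.dim d m₀ n m := by
  obtain ⟨v, hv, h⟩ := exists_finrank_eq_generalRank d m₀ n m
  have h1 := le_two_mul_finrank_vecSections d (quasiHomMult m₀ n m) v hv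
  rw [h, Fin.sum_univ_succ] at h1
  simp only [quasiHomMult, Fin.cons_zero, Fin.cons_succ, Finset.sum_const, Finset.card_univ,
    Fintype.card_fin, smul_eq_mul] at h1
  have h2 := two_mul_virtualDim d m₀ n m
  rw [dim_eq_generalRank_sub_one]
  zify at h1
  linarith

/-! ### Vanishing sequences at a general point of the line -/

/-- In characteristic zero, a polynomial whose Wronskian with `f` vanishes is a scalar multiple of
`f`: comparing leading terms, any such nonzero polynomial has the degree of `f`, and subtracting a
multiple of `f` would lower the degree. -/
theorem exists_eq_C_mul_of_wronskian_eq_zero {f h : Polynomial ℂ} (hf : f ≠ 0)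
    (hw : f * Polynomial.derivative h - Polynomial.derivative f * h = 0) :
    ∃ c : ℂ, h = Polynomial.C c * f := by
  have key : ∀ g : Polynomial ℂ, g ≠ 0 →
      f * Polynomial.derivative g - Polynomial.derivative f * g = 0 →
      g.natDegree = f.natDegree := by
    intro g hg hw
    have h1 : ∀ q : Polynomial ℂ, (Polynomial.X * Polynomial.derivative q).coeff q.natDegree
        = q.leadingCoeff * q.natDegree := by
      intro q
      rcases hq : q.natDegree with _ | n
      · simp
      · rw [Polynomial.coeff_X_mul, Polynomial.coeff_derivative, Polynomial.leadingCoeff, hq]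
        push_cast
        rfl
    have hdeg : ∀ q : Polynomial ℂ, (Polynomial.X * Polynomial.derivative q).natDegree
        ≤ q.natDegree := by
      intro q
      by_cases hq : Polynomial.derivative q = 0
      · simp [hq]
      · have : q.natDegree ≠ 0 := fun h0 => hq (Polynomial.derivative_of_natDegree_zero h0)
        have := Polynomial.natDegree_derivative_lt this
        rw [Polynomial.natDegree_X_mul hq]
        omega
    have h2 : f * (Polynomial.X * Polynomial.derivative g)
        = (Polynomial.X * Polynomial.derivative f) * g := by
      linear_combination Polynomial.X * hw
    have h3 := congrArg (fun q => q.coeff (f.natDegree + g.natDegree)) h2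
    rw [Polynomial.coeff_mul_add_eq_of_natDegree_le le_rfl (hdeg g),
      Polynomial.coeff_mul_add_eq_of_natDegree_le (hdeg f) le_rfl, h1, h1] at h3
    have hf' : f.leadingCoeff ≠ 0 := Polynomial.leadingCoeff_ne_zero.2 hf
    have hg' : g.leadingCoeff ≠ 0 := Polynomial.leadingCoeff_ne_zero.2 hg
    have h4 : (g.natDegree : ℂ) = f.natDegree := by
      refine mul_left_cancel₀ (mul_ne_zero hf' hg') ?_
      rw [Polynomial.leadingCoeff, Polynomial.leadingCoeff] at *
      linear_combination h3
    exact_mod_cast h4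
  -- Subtracting the multiple of `f` with the same leading term lowers the degree.
  by_cases hh : h = 0
  · exact ⟨0, by simp [hh]⟩
  refine ⟨h.leadingCoeff / f.leadingCoeff, ?_⟩
  have hf' : f.leadingCoeff ≠ 0 := Polynomial.leadingCoeff_ne_zero.2 hf
  by_contra hne
  have hg : h - Polynomial.C (h.leadingCoeff / f.leadingCoeff) * f ≠ 0 := sub_ne_zero.2 hne
  have hdeg := key _ hg (by
    rw [Polynomial.derivative_sub, Polynomial.derivative_C_mul]
    linear_combination hw)
  have hlead : (h - Polynomial.C (h.leadingCoeff / f.leadingCoeff) * f).coeff f.natDegree = 0 := by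
    rw [Polynomial.coeff_sub, Polynomial.coeff_C_mul, ← key h hh hw, Polynomial.coeff_natDegree,
      key h hh hw, Polynomial.coeff_natDegree, div_mul_cancel₀ _ hf', sub_self]
  rw [← hdeg, Polynomial.coeff_natDegree, Polynomial.leadingCoeff_eq_zero] at hlead
  exact hg hlead

/-- In a `b`-dimensional space of polynomials, no nonzero element vanishes to order `b` at a
general point. The induction replaces `B` by the space of Wronskians of its elements with a
fixed nonzero `f ∈ B`, which has dimension one less. -/
theorem finite_setOf_exists_pow_dvd (B : Submodule ℂ (Polynomial ℂ)) [FiniteDimensional ℂ B] :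
    {s : ℂ | ∃ f ∈ B, f ≠ 0 ∧
      (Polynomial.X - Polynomial.C s) ^ Module.finrank ℂ B ∣ f}.Finite := by
  induction hn : Module.finrank ℂ B generalizing B with
  | zero =>
    rw [Submodule.finrank_eq_zero] at hn
    subst hn
    refine Set.Finite.subset Set.finite_empty ?_
    rintro s ⟨f, hf, hf0, -⟩
    exact hf0 ((Submodule.mem_bot ℂ).1 hf)
  | succ n ih =>
    have hB : B ≠ ⊥ := by
      rintro rfl
      simp at hn
    obtain ⟨f, hfB, hf⟩ := Submodule.exists_mem_ne_zero_of_ne_bot hB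
    let W : Polynomial ℂ →ₗ[ℂ] Polynomial ℂ := Polynomial.wronskianBilin ℂ f
    have hW : ∀ h, W h = f * Polynomial.derivative h - Polynomial.derivative f * h := fun h => rfl
    have hker : LinearMap.ker (W.domRestrict B) = Submodule.span ℂ {⟨f, hfB⟩} := by
      ext ⟨h, hh⟩
      rw [LinearMap.mem_ker, Submodule.mem_span_singleton, LinearMap.domRestrict_apply, hW]
      constructor
      · intro h0
        obtain ⟨c, hc⟩ := exists_eq_C_mul_of_wronskian_eq_zero hf h0
        exact ⟨c, Subtype.ext (by rw [hc, ← Polynomial.smul_eq_C_mul]; rfl)⟩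
      · rintro ⟨c, hc⟩
        have hc' : c • f = h := congrArg Subtype.val hc
        subst hc'
        rw [Polynomial.derivative_smul, mul_smul_comm, mul_smul_comm, mul_comm, sub_self]
    have hrk : Module.finrank ℂ (B.map W) = n := by
      have h1 := (W.domRestrict B).finrank_range_add_finrank_ker
      have hf0 : (⟨f, hfB⟩ : B) ≠ 0 := fun h => hf (congrArg Subtype.val h)
      rw [hker, finrank_span_singleton hf0, hn, LinearMap.range_domRestrict] at h1
      omega
    refine ((ih (B.map W) hrk).union f.roots.toFinset.finite_toSet).subset ?_
    rintro s ⟨h, hhB, hh, hdvd⟩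
    by_contra hs
    rw [Set.mem_union, not_or] at hs
    have hfs : f.eval s ≠ 0 := fun h0 => hs.2 (by simp [hf, h0])
    have hWh : W h = 0 := by
      by_contra hne
      refine hs.1 ⟨W h, ⟨h, hhB, rfl⟩, hne, ?_⟩
      have h1 := Polynomial.pow_sub_one_dvd_derivative_of_pow_dvd hdvd
      exact dvd_sub (h1.mul_left _) (((pow_dvd_pow _ n.le_succ).trans hdvd).mul_left _)
    obtain ⟨c, rfl⟩ := exists_eq_C_mul_of_wronskian_eq_zero hf hWh
    have h2 := (dvd_pow_self _ n.succ_ne_zero).trans hdvd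
    rw [Polynomial.dvd_iff_isRoot, Polynomial.IsRoot, Polynomial.eval_mul, Polynomial.eval_C] at h2
    have hc : c = 0 := (mul_eq_zero.1 h2).resolve_right hfs
    exact hh (by simp [hc])

/-! ### Binary forms and transversality -/

/-- The forms `Z ^ e f(X, Y)` with `f` a binary form of degree `c`. -/
noncomputable def binaryForms (c e : ℕ) : Submodule ℂ Poly where
  carrier := {F | ∀ u, coeff u F ≠ 0 → u 0 + u 1 = c ∧ u 2 = e}
  zero_mem' := fun u hu => absurd (coeff_zero u) hu
  add_mem' := fun {F G} hF hG u hu => by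
    by_cases h : coeff u F = 0
    · exact hG u fun h' => hu (by rw [coeff_add, h, h', add_zero])
    · exact hF u h
  smul_mem' := fun a F hF u hu => hF u fun h => hu (by rw [coeff_smul, h, smul_zero])

theorem binaryForms_le (c e : ℕ) : binaryForms c e ≤ homogeneousSubmodule (Fin 3) ℂ (c + e) := by
  intro F hF u hu
  have h := hF u hu
  have h1 : Finsupp.weight 1 u = u.degree := by
    rw [Finsupp.degree_eq_weight_one]
    rfl
  rw [h1, Finsupp.degree_eq_sum, Fin.sum_univ_three]
  omega

instance (c e : ℕ) : FiniteDimensional ℂ (binaryForms c e) :=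
  Submodule.finiteDimensional_of_le (binaryForms_le c e)

/-- Linear changes of the first two coordinates: invertible matrices fixing the third coordinate
and commuting with the scalings of the first two. -/
structure IsBinaryChange (M : Matrix (Fin 3) (Fin 3) ℂ) : Prop where
  isUnit : IsUnit M
  apply_two : ∀ v, M.mulVec v 2 = v 2
  commute : ∀ t : ℂ, Commute M (Matrix.diagonal ![t, t, 1])

namespace IsBinaryChange

theorem mul {M N : Matrix (Fin 3) (Fin 3) ℂ} (hM : IsBinaryChange M) (hN : IsBinaryChange N) :
    IsBinaryChange (M * N) where
  isUnit := hM.isUnit.mul hN.isUnit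
  apply_two v := by rw [← Matrix.mulVec_mulVec, hM.apply_two, hN.apply_two]
  commute t := (hM.commute t).mul_left (hN.commute t)

theorem inv {M : Matrix (Fin 3) (Fin 3) ℂ} (hM : IsBinaryChange M) : IsBinaryChange M⁻¹ where
  isUnit := Matrix.isUnit_nonsing_inv_iff.2 hM.isUnit
  apply_two v := by
    rw [← hM.apply_two (M⁻¹.mulVec v), Matrix.mulVec_mulVec,
      Matrix.mul_nonsing_inv _ ((Matrix.isUnit_iff_isUnit_det M).1 hM.isUnit), Matrix.one_mulVec]
  commute t := by
    have hdet := (Matrix.isUnit_iff_isUnit_det M).1 hM.isUnit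
    rw [commute_iff_eq]
    calc M⁻¹ * Matrix.diagonal ![t, t, 1]
        = M⁻¹ * (Matrix.diagonal ![t, t, 1] * M) * M⁻¹ := by
          rw [Matrix.mul_assoc, Matrix.mul_assoc, Matrix.mul_nonsing_inv _ hdet, Matrix.mul_one]
      _ = Matrix.diagonal ![t, t, 1] * M⁻¹ := by
          rw [← (hM.commute t).eq, ← Matrix.mul_assoc, Matrix.nonsing_inv_mul _ hdet,
            Matrix.one_mul]

theorem transvection {j j' : Fin 3} (hj : j ≠ 2) (hj' : j' ≠ 2) (h : j ≠ j') (s : ℂ) :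
    IsBinaryChange (Matrix.transvection j j' s) where
  isUnit := by
    rw [Matrix.isUnit_iff_isUnit_det, Matrix.det_transvection_of_ne _ _ h]
    exact isUnit_one
  apply_two v := by
    simp [Matrix.transvection, Matrix.add_mulVec, Matrix.single_mulVec, hj.symm]
  commute t := by
    unfold Matrix.transvection
    refine (Commute.one_left _).add_left ?_
    have ht : ∀ i : Fin 3, i ≠ 2 → (![t, t, 1] : Fin 3 → ℂ) i = t := by
      intro i hi
      fin_cases i <;> simp_all
    rw [commute_iff_eq]
    ext a b
    rw [Matrix.mul_diagonal, Matrix.diagonal_mul, Matrix.single_apply]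
    split_ifs with hab
    · rw [← hab.1, ← hab.2, ht j hj, ht j' hj', mul_comm]
    · simp

theorem diagonal {s : ℂ} (hs : s ≠ 0) : IsBinaryChange (Matrix.diagonal ![s, 1, 1]) where
  isUnit := by
    rw [Matrix.isUnit_iff_isUnit_det, Matrix.det_diagonal, Fin.prod_univ_three]
    simpa using hs
  apply_two v := by rw [Matrix.mulVec_diagonal]; simp
  commute t := by
    rw [commute_iff_eq, Matrix.diagonal_mul_diagonal, Matrix.diagonal_mul_diagonal]
    congr 1
    ext i
    rw [mul_comm]

/-- A change of the first two coordinates respects the degree in these coordinates, so it commutes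
with every scaling of coefficients that depends only on this degree. -/
theorem subst_coeffScale {M : Matrix (Fin 3) (Fin 3) ℂ} (hM : IsBinaryChange M) (φ : ℕ → ℂ)
    (F : Poly) : subst M (coeffScale (fun u => φ (u 0 + u 1)) F)
      = coeffScale (fun u => φ (u 0 + u 1)) (subst M F) := by
  induction F using MvPolynomial.induction_on' with
  | monomial a r =>
    rw [coeffScale_monomial]
    ext u
    have h1 : monomial a (φ (a 0 + a 1) * r) = φ (a 0 + a 1) • (monomial a r : Poly) := by
      rw [smul_monomial, smul_eq_mul]
    rw [h1, map_smul, coeff_smul, coeff_coeffScale, smul_eq_mul]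
    by_cases hu : coeff u (subst M (monomial a r)) = 0
    · rw [hu, mul_zero, mul_zero]
    -- Comparing with the scaling by `2` shows that `u` and `a` have the same degree in `X`, `Y`.
    have h2 := congrArg (coeff u) (congrArg (fun N => subst N (monomial a r))
      (hM.commute 2).eq)
    rw [← subst_subst, ← subst_subst, subst_diagonal, subst_diagonal, coeff_coeffScale,
      coeffScale_monomial, Fin.prod_univ_three, Fin.prod_univ_three, ← smul_eq_mul _ r,
      ← smul_monomial, map_smul, coeff_smul] at h2
    have h3 : (2 : ℂ) ^ u 0 * 2 ^ u 1 * 1 ^ u 2 = 2 ^ a 0 * 2 ^ a 1 * 1 ^ a 2 :=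
      mul_right_cancel₀ hu h2
    rw [one_pow, one_pow, mul_one, mul_one, ← pow_add, ← pow_add] at h3
    have h4 : u 0 + u 1 = a 0 + a 1 :=
      Nat.pow_right_injective (le_refl 2) (Nat.cast_injective (R := ℂ) (by simpa using h3))
    rw [h4]
  | add p q hp hq => simp only [map_add, hp, hq]

theorem subst_mem_binaryForms {M : Matrix (Fin 3) (Fin 3) ℂ} (hM : IsBinaryChange M) {c e : ℕ}
    {F : Poly} (hF : F ∈ binaryForms c e) : subst M F ∈ binaryForms c e := by
  intro u hu
  have h1 : coeffScale (fun u => if u 0 + u 1 = c then 1 else 0) F = F := by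
    ext u
    rw [coeff_coeffScale]
    by_cases hu : coeff u F = 0
    · rw [hu, mul_zero]
    · rw [if_pos (hF u hu).1, one_mul]
  have h2 := (isHomogeneous_subst (binaryForms_le c e hF) M).degree_eq hu
  have h3 := hM.subst_coeffScale (fun j => if j = c then 1 else 0) F
  rw [h1] at h3
  rw [h3, coeff_coeffScale] at hu
  have h4 : u 0 + u 1 = c := by
    by_contra h
    simp [h] at hu
  omega

end IsBinaryChange

/-- For `j ∈ {0, 1}`, the polynomial in one variable obtained by setting all coordinates but the
`j`-th equal to `1`. -/
noncomputable def dehomogenize (j : Fin 3) : Poly →ₐ[ℂ] Polynomial ℂ :=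
  aeval (Function.update (fun _ => 1) j Polynomial.X)

theorem dehomogenize_eq_sum (j : Fin 3) (F : Poly) :
    dehomogenize j F = ∑ u ∈ F.support, Polynomial.C (coeff u F) * Polynomial.X ^ u j := by
  rw [dehomogenize, aeval_def, eval₂_eq']
  refine Finset.sum_congr rfl fun u _ => ?_
  rw [Finset.prod_eq_single j (fun i _ hi => by simp [Function.update_of_ne hi]) (by simp),
    Function.update_self]
  rfl

theorem coeff_dehomogenize {j : Fin 3} (hj : j ≠ 2) {c e : ℕ} {F : Poly}
    (hF : F ∈ binaryForms c e) {u : Fin 3 →₀ ℕ} (hu : u 0 + u 1 = c) (hu2 : u 2 = e) :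
    (dehomogenize j F).coeff (u j) = coeff u F := by
  rw [dehomogenize_eq_sum, Polynomial.finsetSum_coeff]
  simp only [Polynomial.coeff_C_mul_X_pow]
  rw [Finset.sum_eq_single u, if_pos rfl]
  · intro a ha hau
    rw [if_neg]
    intro h
    have h1 := hF a (mem_support_iff.1 ha)
    refine hau ?_
    ext i
    fin_cases j <;> fin_cases i <;> simp at h hj ⊢ <;> omega
  · intro h
    rw [if_pos rfl]
    exact notMem_support_iff.1 h

theorem dehomogenize_transvection {j j' : Fin 3} (h : j ≠ j') (s : ℂ) (F : Poly) :
    dehomogenize j (subst (Matrix.transvection j j' s) F)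
      = Polynomial.taylorAlgHom s (dehomogenize j F) := by
  have : (dehomogenize j).comp (subst (Matrix.transvection j j' s))
      = (Polynomial.taylorAlgHom s).comp (dehomogenize j) := by
    apply algHom_ext
    intro i
    rw [AlgHom.comp_apply, AlgHom.comp_apply, subst, dehomogenize, aeval_X, aeval_X]
    rw [map_sum]
    simp only [map_mul, algHom_C, aeval_X]
    by_cases hi : i = j
    · subst hi
      rw [Function.update_self]
      simp [Matrix.transvection, Matrix.single_apply, Matrix.one_apply, add_mul,
        Finset.sum_add_distrib, Function.update_of_ne h.symm, apply_ite Polynomial.C]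
    · rw [Function.update_of_ne hi]
      simp [Matrix.transvection, Matrix.one_apply, Ne.symm hi, apply_ite Polynomial.C,
        Function.update_of_ne hi]
  exact DFunLike.congr_fun this F

/-- After a suitable change of coordinates, a `b`-dimensional space of binary forms has no nonzero
element vanishing to order `b` at a given coordinate point of the line. -/
theorem exists_isBinaryChange_of_finrank {j : Fin 3} (hj : j ≠ 2) {c e : ℕ} (B : Submodule ℂ Poly)
    (hB : B ≤ binaryForms c e) :
    ∃ M, IsBinaryChange M ∧ ∀ F ∈ B,
      (∀ u, u j < Module.finrank ℂ B → coeff u (subst M F) = 0) → F = 0 := by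
  obtain ⟨j', hj', hjj'⟩ : ∃ j' : Fin 3, j' ≠ 2 ∧ j ≠ j' := by
    fin_cases j
    · exact ⟨1, by decide, by decide⟩
    · exact ⟨0, by decide, by decide⟩
    · exact absurd rfl hj
  have : FiniteDimensional ℂ B := Submodule.finiteDimensional_of_le hB
  have hinj : ∀ F ∈ B, dehomogenize j F = 0 → F = 0 := by
    intro F hF h0
    ext u
    rw [coeff_zero]
    by_contra hu
    have h1 := hB hF u hu
    rw [← coeff_dehomogenize hj (hB hF) h1.1 h1.2, h0, Polynomial.coeff_zero] at hu
    exact hu rfl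
  have hrk : Module.finrank ℂ (B.map (dehomogenize j).toLinearMap) = Module.finrank ℂ B := by
    rw [← LinearMap.range_domRestrict]
    refine LinearMap.finrank_range_of_inj ?_
    rw [← LinearMap.ker_eq_bot, eq_bot_iff]
    rintro ⟨F, hF⟩ h0
    exact (Submodule.mem_bot ℂ).2 (Subtype.ext (hinj F hF h0))
  obtain ⟨s, hs⟩ := (finite_setOf_exists_pow_dvd
    (B.map (dehomogenize j).toLinearMap)).exists_notMem
  refine ⟨_, IsBinaryChange.transvection hj hj' hjj' s, fun F hF h => ?_⟩
  by_contra hne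
  refine hs ⟨_, ⟨F, hF, rfl⟩, fun h0 => hne (hinj F hF h0), ?_⟩
  rw [hrk]
  have h1 : Polynomial.X ^ Module.finrank ℂ B
      ∣ dehomogenize j (subst (Matrix.transvection j j' s) F) := by
    rw [dehomogenize_eq_sum]
    refine Finset.dvd_sum fun u hu => Dvd.dvd.mul_left (pow_dvd_pow _ ?_) _
    by_contra hlt
    exact (mem_support_iff.1 hu) (h u (not_le.1 hlt))
  rw [dehomogenize_transvection hjj'] at h1
  have h2 := map_dvd (Polynomial.taylorAlgHom (-s)) h1
  rw [map_pow] at h2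
  simp only [Polynomial.taylorAlgHom_apply, Polynomial.taylor_taylor, Polynomial.taylor_X] at h2
  rw [neg_add_cancel, Polynomial.taylor_zero, Polynomial.C_neg, ← sub_eq_add_neg] at h2
  exact h2

/-- The exponent of `X ^ i Y ^ (c - i) Z ^ e`. -/
noncomputable def binaryExponent (c e i : ℕ) : Fin 3 →₀ ℕ :=
  Finsupp.equivFunOnFinite.symm ![i, c - i, e]

theorem eq_binaryExponent {c e : ℕ} {F : Poly} (hF : F ∈ binaryForms c e) {u : Fin 3 →₀ ℕ}
    (hu : coeff u F ≠ 0) : u = binaryExponent c e (u 0) := by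
  have h := hF u hu
  ext i
  fin_cases i
  · rfl
  · show u 1 = c - u 0
    omega
  · exact h.2

/-- The torus `X ↦ s X` degenerates `B` to the span of the `X ^ j Y ^ (c - j)` with `j < b`, from
which `A` is disjoint; hence `A` is disjoint from a general translate of `B` under the torus. -/
theorem exists_diagonal_disjoint {c e : ℕ} (A B : Submodule ℂ Poly)
    (hA : A ≤ binaryForms c e) (hB : B ≤ binaryForms c e)
    (hAB : Module.finrank ℂ A + Module.finrank ℂ B ≤ c + 1)
    (hA' : ∀ F ∈ A, (∀ u, u 1 < Module.finrank ℂ A → coeff u F = 0) → F = 0)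
    (hB' : ∀ F ∈ B, (∀ u, u 0 < Module.finrank ℂ B → coeff u F = 0) → F = 0) :
    ∃ s : ℂ, s ≠ 0 ∧ ∀ F ∈ B, subst (Matrix.diagonal ![s, 1, 1]) F ∈ A → F = 0 := by
  have : FiniteDimensional ℂ A := Submodule.finiteDimensional_of_le hA
  have : FiniteDimensional ℂ B := Submodule.finiteDimensional_of_le hB
  set a := Module.finrank ℂ A with ha
  set b := Module.finrank ℂ B with hb
  -- A basis of `B` that is reduced with respect to the first `b` monomials.
  let L : B →ₗ[ℂ] (Fin b → ℂ) :=
    LinearMap.pi fun i => (lcoeff ℂ (binaryExponent c e i)).comp B.subtype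
  have hL : Function.Injective L := by
    rw [← LinearMap.ker_eq_bot, eq_bot_iff]
    rintro ⟨F, hF⟩ h0
    refine (Submodule.mem_bot ℂ).2 (Subtype.ext (hB' F hF fun u hu => ?_))
    by_contra hne
    have h1 : coeff (binaryExponent c e (u 0)) F = 0 :=
      congrFun (LinearMap.mem_ker.1 h0) ⟨u 0, hu⟩
    rw [← eq_binaryExponent (hB hF) hne] at h1
    exact hne h1
  let E : B ≃ₗ[ℂ] (Fin b → ℂ) := LinearEquiv.ofInjectiveOfFinrankEq L hL (by simp [hb])
  have hE : ∀ F i, E F i = coeff (binaryExponent c e i) (F : Poly) := fun F i => rfl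
  let β : Fin b → B := fun j => E.symm (Pi.single j 1)
  have hβ : ∀ (j : Fin b) (i : Fin b),
      coeff (binaryExponent c e i) (β j : Poly) = (Pi.single j 1 : Fin b → ℂ) i := by
    intro j i
    rw [← hE, LinearEquiv.apply_symm_apply]
  have hβ0 : ∀ (j : Fin b) u, u 0 < (j : ℕ) → coeff u (β j : Poly) = 0 := by
    intro j u hu
    by_contra hne
    have h1 := hβ j ⟨u 0, hu.trans j.2⟩
    rw [Pi.single_eq_of_ne (by rw [Ne, Fin.ext_iff]; exact hu.ne)] at h1
    rw [eq_binaryExponent (hB (β j).2) hne] at hne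
    exact hne h1
  have hsum : ∀ F : B, (F : Poly) = ∑ j, E F j • (β j : Poly) := by
    intro F
    have h1 : F = ∑ j, E F j • β j := by
      apply E.injective
      rw [map_sum]
      ext i
      simp [β, Pi.single_apply]
    have h2 := congrArg B.subtype h1
    rw [map_sum] at h2
    exact h2
  -- The family of linear maps whose kernels measure the intersections.
  let Ψ : ℂ → (A × (Fin b → ℂ)) →ₗ[ℂ] Poly := fun s =>
    A.subtype.comp (LinearMap.fst ℂ A (Fin b → ℂ)) -
      ∑ j, ((LinearMap.proj j).comp (LinearMap.snd ℂ A (Fin b → ℂ))).smulRight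
        (coeffScale (fun u => s ^ (u 0 - j)) (β j : Poly))
  have hΨ : ∀ s x u, coeff u (Ψ s x)
      = coeff u (x.1 : Poly) - ∑ j, x.2 j * (s ^ (u 0 - j) * coeff u (β j : Poly)) := by
    intro s x u
    simp only [Ψ, LinearMap.sub_apply, LinearMap.sum_apply, coeff_sub, coeff_sum,
      LinearMap.smulRight_apply, coeff_smul, coeff_coeffScale, smul_eq_mul]
    rfl
  have hΨ0 : LinearMap.ker (Ψ 0) = ⊥ := by
    rw [eq_bot_iff]
    rintro ⟨⟨F, hF⟩, y⟩ h0
    have h1 : ∀ u, coeff u F = ∑ j, y j * (0 ^ (u 0 - j) * coeff u (β j : Poly)) := by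
      intro u
      have := hΨ 0 (⟨F, hF⟩, y) u
      rw [LinearMap.mem_ker.1 h0, coeff_zero] at this
      exact (sub_eq_zero.1 this.symm)
    have hF0 : F = 0 := by
      refine hA' F hF fun u hu => ?_
      by_contra hne
      have hu2 := (hA hF u hne).1
      refine hne ((h1 u).trans (Finset.sum_eq_zero fun j _ => ?_))
      have hj := j.2
      rw [zero_pow (by omega), zero_mul, mul_zero]
    have hy : y = 0 := by
      ext i
      have h2 := h1 (binaryExponent c e i)
      rw [hF0, coeff_zero, Finset.sum_eq_single i] at h2
      · have h3 : binaryExponent c e i 0 = i := rfl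
        rw [h3, Nat.sub_self, pow_zero, one_mul, hβ, Pi.single_eq_same, mul_one] at h2
        exact h2.symm
      · intro j _ hj
        rw [hβ, Pi.single_eq_of_ne hj.symm, mul_zero, mul_zero]
      · simp
    subst hF0
    rw [hy]
    rfl
  have hfin := finite_setOf_finrank_lt (V := A × (Fin b → ℂ))
    (fun s u => (lcoeff ℂ u).comp (Ψ s)) (by
      intro u x
      refine ⟨Polynomial.C (coeff u (x.1 : Poly)) - ∑ j, Polynomial.C (x.2 j)
        * (Polynomial.X ^ (u 0 - j) * Polynomial.C (coeff u (β j : Poly))), fun s => ?_⟩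
      rw [LinearMap.comp_apply, lcoeff_apply, hΨ]
      simp only [Polynomial.eval_sub, Polynomial.eval_C, Polynomial.eval_finsetSum,
        Polynomial.eval_mul, Polynomial.eval_pow, Polynomial.eval_X])
    (fun s => LinearMap.ker (Ψ s)) (by
      intro s x
      rw [LinearMap.mem_ker, MvPolynomial.ext_iff]
      rfl) 0
  obtain ⟨s, hs⟩ := (hfin.union (Set.finite_singleton (0 : ℂ))).exists_notMem
  rw [Set.mem_union, not_or] at hs
  have hs0 : s ≠ 0 := hs.2
  have hker : LinearMap.ker (Ψ s) = ⊥ := by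
    have h1 : Module.finrank ℂ (LinearMap.ker (Ψ s)) ≤ Module.finrank ℂ (LinearMap.ker (Ψ 0)) :=
      not_lt.1 hs.1
    rw [hΨ0, finrank_bot, Nat.le_zero, Submodule.finrank_eq_zero] at h1
    exact h1
  refine ⟨s, hs0, fun F hF hFA => ?_⟩
  have h1 : ((⟨_, hFA⟩, fun j => E ⟨F, hF⟩ j * s ^ (j : ℕ)) : A × (Fin b → ℂ))
      ∈ LinearMap.ker (Ψ s) := by
    rw [LinearMap.mem_ker]
    ext u
    rw [hΨ, coeff_zero, sub_eq_zero]
    have h2 := congrArg (coeff u) (hsum ⟨F, hF⟩)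
    simp only [coeff_sum, coeff_smul, smul_eq_mul] at h2
    simp only [subst_diagonal, coeff_coeffScale]
    rw [h2, Finset.mul_sum]
    refine Finset.sum_congr rfl fun j _ => ?_
    rcases lt_or_ge (u 0) j with hlt | hge
    · rw [hβ0 j u hlt]
      ring
    · have h3 : s ^ u 0 = s ^ (j : ℕ) * s ^ (u 0 - j) := by
        rw [← pow_add, Nat.add_sub_cancel' hge]
      simp [Fin.prod_univ_three, h3]
      ring
  rw [hker, Submodule.mem_bot, Prod.ext_iff] at h1
  have h2 : subst (Matrix.diagonal ![s, 1, 1]) F = 0 := congrArg Subtype.val h1.1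
  exact subst_injective (IsBinaryChange.diagonal hs0).isUnit (h2.trans (map_zero _).symm)

/-- Spaces of binary forms whose dimensions add up to at most `c + 1` can be made disjoint by a
linear change of coordinates. -/
theorem exists_isBinaryChange_disjoint {c e : ℕ} (A B : Submodule ℂ Poly)
    (hA : A ≤ binaryForms c e) (hB : B ≤ binaryForms c e)
    (hAB : Module.finrank ℂ A + Module.finrank ℂ B ≤ c + 1) :
    ∃ M, IsBinaryChange M ∧ ∀ F ∈ B, subst M F ∈ A → F = 0 := by
  obtain ⟨M, hM, hMA⟩ := exists_isBinaryChange_of_finrank (j := 1) (by decide) A hA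
  obtain ⟨N, hN, hNB⟩ := exists_isBinaryChange_of_finrank (j := 0) (by decide) B hB
  have hrA := finrank_map_of_injective (subst M).toLinearMap (subst_injective hM.isUnit) A
  have hrB := finrank_map_of_injective (subst N).toLinearMap (subst_injective hN.isUnit) B
  obtain ⟨s, hs, h⟩ := exists_diagonal_disjoint (c := c) (e := e) (A.map (subst M).toLinearMap)
    (B.map (subst N).toLinearMap)
    (Submodule.map_le_iff_le_comap.2 fun F hF => hM.subst_mem_binaryForms (hA hF))
    (Submodule.map_le_iff_le_comap.2 fun F hF => hN.subst_mem_binaryForms (hB hF))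
    (by rw [hrA, hrB]; exact hAB)
    (by
      rw [hrA]
      rintro _ ⟨F, hF, rfl⟩ h
      rw [hMA F hF h, map_zero])
    (by
      rw [hrB]
      rintro _ ⟨F, hF, rfl⟩ h
      rw [hNB F hF h, map_zero])
  refine ⟨N * (Matrix.diagonal ![s, 1, 1] * M⁻¹),
    hN.mul ((IsBinaryChange.diagonal hs).mul hM.inv), fun F hF hFA => ?_⟩
  refine subst_injective hN.isUnit ((h (subst N F) ⟨F, hF, rfl⟩ ⟨_, hFA, ?_⟩).trans
    (map_zero _).symm)
  show subst M _ = _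
  rw [subst_subst, subst_subst, Matrix.mul_assoc, Matrix.mul_assoc,
    Matrix.nonsing_inv_mul _ ((Matrix.isUnit_iff_isUnit_det M).1 hM.isUnit), Matrix.mul_one]

/-- Spaces of binary forms meet in the expected dimension after a suitable linear change of
coordinates in one of them. -/
theorem exists_isBinaryChange_finrank_inf_le {c e : ℕ} (A B : Submodule ℂ Poly)
    (hA : A ≤ binaryForms c e) (hB : B ≤ binaryForms c e) :
    ∃ M, IsBinaryChange M ∧ Module.finrank ℂ (A ⊓ B.map (subst M).toLinearMap : Submodule ℂ Poly)
      ≤ Module.finrank ℂ A + Module.finrank ℂ B - (c + 1) := by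
  have : FiniteDimensional ℂ A := Submodule.finiteDimensional_of_le hA
  have : FiniteDimensional ℂ B := Submodule.finiteDimensional_of_le hB
  -- Shrink `B` to a subspace of dimension complementary to that of `A`.
  obtain ⟨r, hr⟩ : ∃ r, r = min (Module.finrank ℂ B) (c + 1 - Module.finrank ℂ A) := ⟨_, rfl⟩
  obtain ⟨B', hB', hrB'⟩ : ∃ B' ≤ B, Module.finrank ℂ B' = r := by
    obtain ⟨f, hf⟩ := exists_linearIndependent_of_le_finrank (R := ℂ) (M := B) (n := r) (by omega)
    refine ⟨(Submodule.span ℂ (Set.range f)).map B.subtype, Submodule.map_subtype_le _ _, ?_⟩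
    rw [finrank_map_of_injective _ B.subtype_injective, finrank_span_eq_card hf, Fintype.card_fin]
  by_cases hac : c + 1 < Module.finrank ℂ A
  · refine ⟨_, (IsBinaryChange.diagonal one_ne_zero), ?_⟩
    refine (Submodule.finrank_mono inf_le_right).trans ?_
    refine (Submodule.finrank_map_le _ B).trans ?_
    omega
  obtain ⟨M, hM, h⟩ := exists_isBinaryChange_disjoint A B' hA (hB'.trans hB) (by omega)
  refine ⟨M, hM, ?_⟩
  have hinj := subst_injective hM.isUnit
  have hdisj : Disjoint (A ⊓ B.map (subst M).toLinearMap) (B'.map (subst M).toLinearMap) := by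
    rw [Submodule.disjoint_def]
    rintro _ hG ⟨F, hF, rfl⟩
    have : F = 0 := h F hF hG.1
    rw [this, map_zero]
  have hle : (A ⊓ B.map (subst M).toLinearMap) ⊔ B'.map (subst M).toLinearMap
      ≤ B.map (subst M).toLinearMap := sup_le inf_le_right (Submodule.map_mono hB')
  have : FiniteDimensional ℂ B' := Submodule.finiteDimensional_of_le hB'
  have h1 := Submodule.finrank_mono hle
  have h2 := Submodule.finrank_sup_add_finrank_inf_eq (A ⊓ B.map (subst M).toLinearMap)
    (B'.map (subst M).toLinearMap)
  rw [disjoint_iff.1 hdisj, finrank_bot] at h2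
  rw [finrank_map_of_injective _ hinj] at h1 h2
  omega

/-! ### The degeneration -/

/-- The forms in `vecSections d ν q` whose monomials have degree at least `c` in `X`, `Y`; that is,
those that vanish to order `c` at `(0, 0, 1)`. -/
noncomputable def highSections {κ : Type*} (d c : ℕ) (ν : κ → ℕ) (q : κ → Fin 3 → ℂ) :
    Submodule ℂ Poly where
  carrier := {F | F ∈ vecSections d ν q ∧ ∀ u, u 0 + u 1 < c → coeff u F = 0}
  zero_mem' := ⟨zero_mem _, fun u _ => coeff_zero u⟩
  add_mem' := fun {F G} hF hG => ⟨add_mem hF.1 hG.1, fun u hu => by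
    rw [coeff_add, hF.2 u hu, hG.2 u hu, add_zero]⟩
  smul_mem' := fun a F hF => ⟨Submodule.smul_mem _ a hF.1, fun u hu => by
    rw [coeff_smul, hF.2 u hu, smul_zero]⟩

/-- The forms in `vecSections d μ p` whose monomials have degree less than `c` in `X`, `Y`; that is,
those divisible by `Z ^ (d + 1 - c)`. -/
noncomputable def lowSections {ι : Type*} (d c : ℕ) (μ : ι → ℕ) (p : ι → Fin 3 → ℂ) :
    Submodule ℂ Poly where
  carrier := {F | F ∈ vecSections d μ p ∧ ∀ u, c ≤ u 0 + u 1 → coeff u F = 0}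
  zero_mem' := ⟨zero_mem _, fun u _ => coeff_zero u⟩
  add_mem' := fun {F G} hF hG => ⟨add_mem hF.1 hG.1, fun u hu => by
    rw [coeff_add, hF.2 u hu, hG.2 u hu, add_zero]⟩
  smul_mem' := fun a F hF => ⟨Submodule.smul_mem _ a hF.1, fun u hu => by
    rw [coeff_smul, hF.2 u hu, smul_zero]⟩

instance {κ : Type*} (d c : ℕ) (ν : κ → ℕ) (q : κ → Fin 3 → ℂ) :
    FiniteDimensional ℂ (highSections d c ν q) :=
  Submodule.finiteDimensional_of_le (S₂ := vecSections d ν q) fun _ hF => hF.1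

instance {ι : Type*} (d c : ℕ) (μ : ι → ℕ) (p : ι → Fin 3 → ℂ) :
    FiniteDimensional ℂ (lowSections d c μ p) :=
  Submodule.finiteDimensional_of_le (S₂ := vecSections d μ p) fun _ hF => hF.1

/-- The forms `u` of degree `d` such that `∑ t ^ (c - j) u_j` vanishes to the prescribed orders
at the points `q` and `∑ t ^ (j - c) u_j` at the points `p`, where `u_j` is the part of `u` of
degree `j` in `X`, `Y` and the exponents are truncated at `0`. For `t ≠ 0` this is, up to
isomorphism, a linear system based at the points `q` and at the contractions of the points `p`
towards `(0, 0, 1)`; for `t = 0` it is a fibre product of systems on the two components of the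
degenerate plane. -/
noncomputable def gluedSections {ι κ : Type*} (d c : ℕ) (μ : ι → ℕ) (p : ι → Fin 3 → ℂ)
    (ν : κ → ℕ) (q : κ → Fin 3 → ℂ) (t : ℂ) : Submodule ℂ Poly :=
  homogeneousSubmodule (Fin 3) ℂ d ⊓
    ((vecSections d ν q).comap (coeffScale fun u => t ^ (c - (u 0 + u 1))) ⊓
      (vecSections d μ p).comap (coeffScale fun u => t ^ (u 0 + u 1 - c)))

theorem mem_gluedSections {ι κ : Type*} {d c : ℕ} {μ : ι → ℕ} {p : ι → Fin 3 → ℂ}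
    {ν : κ → ℕ} {q : κ → Fin 3 → ℂ} {t : ℂ} {F : Poly} :
    F ∈ gluedSections d c μ p ν q t ↔ F.IsHomogeneous d ∧
      coeffScale (fun u => t ^ (c - (u 0 + u 1))) F ∈ vecSections d ν q ∧
      coeffScale (fun u => t ^ (u 0 + u 1 - c)) F ∈ vecSections d μ p :=
  Iff.rfl

instance {ι κ : Type*} (d c : ℕ) (μ : ι → ℕ) (p : ι → Fin 3 → ℂ)
    (ν : κ → ℕ) (q : κ → Fin 3 → ℂ) (t : ℂ) :
    FiniteDimensional ℂ (gluedSections d c μ p ν q t) :=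
  Submodule.finiteDimensional_of_le (S₂ := homogeneousSubmodule (Fin 3) ℂ d) inf_le_left

/-- For `t ≠ 0`, scaling the part of degree `j` in `X`, `Y` by `t ^ (-max (c - j) 0)` embeds the
linear system at the contracted points into `gluedSections`. -/
theorem finrank_vecSections_sumElim_le {ι κ : Type*} (d c : ℕ) (μ : ι → ℕ) (p : ι → Fin 3 → ℂ)
    (ν : κ → ℕ) (q : κ → Fin 3 → ℂ) {t : ℂ} (ht : t ≠ 0) :
    Module.finrank ℂ (vecSections d (Sum.elim μ ν)
        (Sum.elim (fun i => (Matrix.diagonal ![t, t, 1]).mulVec (p i)) q))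
      ≤ Module.finrank ℂ (gluedSections d c μ p ν q t) := by
  have hinv : ∀ F : Poly, coeffScale (fun u => t ^ (c - (u 0 + u 1)))
      (coeffScale (fun u => t⁻¹ ^ (c - (u 0 + u 1))) F) = F := by
    intro F
    ext u
    rw [coeff_coeffScale, coeff_coeffScale, ← mul_assoc, ← mul_pow, mul_inv_cancel₀ ht, one_pow,
      one_mul]
  have hunit : IsUnit (Matrix.diagonal ![t, t, 1]) := by
    rw [Matrix.isUnit_iff_isUnit_det, Matrix.det_diagonal, Fin.prod_univ_three]
    simpa using ht
  rw [← finrank_map_of_injective (coeffScale fun u => t⁻¹ ^ (c - (u 0 + u 1)))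
    (Function.LeftInverse.injective hinv)]
  refine Submodule.finrank_mono ?_
  rintro _ ⟨F, ⟨hF, hv⟩, rfl⟩
  refine mem_gluedSections.2 ⟨isHomogeneous_coeffScale hF _, ?_, ?_⟩
  · rw [hinv]
    exact ⟨hF, fun k => hv (Sum.inr k)⟩
  · have h1 : coeffScale (fun u => t ^ (u 0 + u 1 - c))
        (coeffScale (fun u => t⁻¹ ^ (c - (u 0 + u 1))) F)
        = t⁻¹ ^ c • subst (Matrix.diagonal ![t, t, 1]) F := by
      ext u
      rw [coeff_smul, subst_diagonal, coeff_coeffScale, coeff_coeffScale, coeff_coeffScale,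
        Fin.prod_univ_three, smul_eq_mul, ← mul_assoc, ← mul_assoc]
      congr 1
      show t ^ (u 0 + u 1 - c) * t⁻¹ ^ (c - (u 0 + u 1)) = t⁻¹ ^ c * (t ^ u 0 * t ^ u 1 * 1 ^ u 2)
      rw [one_pow, mul_one, ← pow_add]
      rcases le_total c (u 0 + u 1) with h | h
      · obtain ⟨k, hk⟩ := Nat.exists_eq_add_of_le h
        rw [hk, Nat.add_sub_cancel_left, Nat.sub_eq_zero_of_le (Nat.le_add_right _ _), pow_zero,
          pow_add, ← mul_assoc, ← mul_pow, inv_mul_cancel₀ ht, one_pow, one_mul, mul_one]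
      · obtain ⟨k, hk⟩ := Nat.exists_eq_add_of_le h
        rw [Nat.sub_eq_zero_of_le h, hk, Nat.add_sub_cancel_left, pow_add, mul_right_comm,
          ← mul_pow, inv_mul_cancel₀ ht, one_pow, pow_zero]
    rw [h1]
    refine Submodule.smul_mem _ _ ((subst_mem_vecSections hunit hF).2 ⟨hF, fun i => ?_⟩)
    exact hv (Sum.inl i)

theorem exists_polynomial_apply_coeffScale (T : Poly →ₗ[ℂ] ℂ) (f : (Fin 3 →₀ ℕ) → ℕ) (F : Poly) :
    ∃ P : Polynomial ℂ, ∀ t, T (coeffScale (fun u => t ^ f u) F) = P.eval t := by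
  induction F using MvPolynomial.induction_on' with
  | monomial a r =>
    refine ⟨Polynomial.X ^ f a * Polynomial.C (T (monomial a r)), fun t => ?_⟩
    rw [coeffScale_monomial, ← smul_eq_mul, ← smul_monomial, map_smul]
    rw [smul_eq_mul, Polynomial.eval_mul, Polynomial.eval_pow, Polynomial.eval_X, Polynomial.eval_C]
  | add p q hp hq =>
    obtain ⟨P, hP⟩ := hp
    obtain ⟨Q, hQ⟩ := hq
    exact ⟨P + Q, fun t => by rw [map_add, map_add, hP, hQ, Polynomial.eval_add]⟩

/-- A general member of the family has at most the dimension of the degenerate member. -/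
theorem exists_finrank_gluedSections_le {ι κ : Type*} (d c : ℕ) (μ : ι → ℕ) (p : ι → Fin 3 → ℂ)
    (ν : κ → ℕ) (q : κ → Fin 3 → ℂ) :
    ∃ t : ℂ, t ≠ 0 ∧ Module.finrank ℂ (gluedSections d c μ p ν q t)
      ≤ Module.finrank ℂ (gluedSections d c μ p ν q 0) := by
  have hfin := finite_setOf_finrank_lt_of_le (homogeneousSubmodule (Fin 3) ℂ d)
    (I := {x : κ × (Fin 3 →₀ ℕ) // x.2.degree < ν x.1} ⊕
      {x : ι × (Fin 3 →₀ ℕ) // x.2.degree < μ x.1})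
    (fun t => Sum.elim
      (fun x => ((lcoeff ℂ x.1.2).comp (taylorAt (q x.1.1)).toLinearMap).comp
        (coeffScale fun u => t ^ (c - (u 0 + u 1))))
      (fun x => ((lcoeff ℂ x.1.2).comp (taylorAt (p x.1.1)).toLinearMap).comp
        (coeffScale fun u => t ^ (u 0 + u 1 - c))))
    (by
      rintro (x | x) F -
      · exact exists_polynomial_apply_coeffScale
          ((lcoeff ℂ x.1.2).comp (taylorAt (q x.1.1)).toLinearMap) (fun u => c - (u 0 + u 1)) F
      · exact exists_polynomial_apply_coeffScale
          ((lcoeff ℂ x.1.2).comp (taylorAt (p x.1.1)).toLinearMap) (fun u => u 0 + u 1 - c) F)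
    (gluedSections d c μ p ν q) (by
      intro t F
      refine and_congr_right fun hF => ?_
      constructor
      · rintro ⟨h1, h2⟩ (x | x)
        · exact h1.2 _ _ x.2
        · exact h2.2 _ _ x.2
      · intro h
        exact ⟨⟨isHomogeneous_coeffScale hF _, fun k a ha => h (Sum.inl ⟨(k, a), ha⟩)⟩,
          ⟨isHomogeneous_coeffScale hF _, fun i a ha => h (Sum.inr ⟨(i, a), ha⟩)⟩⟩) 0
  obtain ⟨t, ht⟩ := (hfin.union (Set.finite_singleton (0 : ℂ))).exists_notMem
  rw [Set.mem_union, not_or] at ht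
  exact ⟨t, ht.2, not_lt.1 ht.1⟩

theorem finrank_map_add_finrank_inf_ker {E E' : Type*} [AddCommGroup E] [Module ℂ E]
    [AddCommGroup E'] [Module ℂ E'] (f : E →ₗ[ℂ] E') (S : Submodule ℂ E) [FiniteDimensional ℂ S] :
    Module.finrank ℂ (S.map f) + Module.finrank ℂ (S ⊓ LinearMap.ker f : Submodule ℂ E)
      = Module.finrank ℂ S := by
  have h1 := (f.domRestrict S).finrank_range_add_finrank_ker
  rw [LinearMap.range_domRestrict, LinearMap.ker_domRestrict] at h1
  rw [← h1, ← Submodule.map_comap_subtype, finrank_map_of_injective _ S.subtype_injective]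

/-- The projection onto the part of degree `c` in `X`, `Y`; on either component of the degenerate
plane this is the restriction to the double curve. -/
noncomputable def binaryPart (c : ℕ) : Poly →ₗ[ℂ] Poly :=
  coeffScale fun u => if u 0 + u 1 = c then 1 else 0

theorem mem_ker_binaryPart {c : ℕ} {F : Poly} :
    F ∈ LinearMap.ker (binaryPart c) ↔ ∀ u, u 0 + u 1 = c → coeff u F = 0 := by
  rw [LinearMap.mem_ker, binaryPart, MvPolynomial.ext_iff]
  refine forall_congr' fun u => ?_
  rw [coeff_coeffScale, coeff_zero]
  split_ifs with h <;> simp [h]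

theorem binaryPart_mem_binaryForms {d c : ℕ} {F : Poly} (hF : F.IsHomogeneous d) :
    binaryPart c F ∈ binaryForms c (d - c) := by
  intro u hu
  rw [binaryPart, coeff_coeffScale] at hu
  have h1 := hF.degree_eq (right_ne_zero_of_mul hu)
  have h2 : u 0 + u 1 = c := by
    by_contra h
    simp [h] at hu
  omega

theorem highSections_inf_ker {κ : Type*} (d c : ℕ) (ν : κ → ℕ) (q : κ → Fin 3 → ℂ) :
    highSections d c ν q ⊓ LinearMap.ker (binaryPart c) = highSections d (c + 1) ν q := by
  ext F
  rw [Submodule.mem_inf, mem_ker_binaryPart]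
  constructor
  · rintro ⟨⟨h1, h2⟩, h3⟩
    refine ⟨h1, fun u hu => ?_⟩
    rcases Nat.lt_succ_iff_lt_or_eq.1 hu with h | h
    exacts [h2 u h, h3 u h]
  · rintro ⟨h1, h2⟩
    exact ⟨⟨h1, fun u hu => h2 u (by omega)⟩, fun u hu => h2 u (by omega)⟩

theorem lowSections_inf_ker {ι : Type*} (d c : ℕ) (μ : ι → ℕ) (p : ι → Fin 3 → ℂ) :
    lowSections d (c + 1) μ p ⊓ LinearMap.ker (binaryPart c) = lowSections d c μ p := by
  ext F
  rw [Submodule.mem_inf, mem_ker_binaryPart]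
  constructor
  · rintro ⟨⟨h1, h2⟩, h3⟩
    refine ⟨h1, fun u hu => ?_⟩
    rcases hu.lt_or_eq with h | h
    exacts [h2 u h, h3 u h.symm]
  · rintro ⟨h1, h2⟩
    exact ⟨⟨h1, fun u hu => h2 u (by omega)⟩, fun u hu => h2 u (by omega)⟩

/-- The system on the degenerate plane is a fibre product over the space of binary forms on the
double curve. -/
theorem finrank_gluedSections_zero_le {ι κ : Type*} (d c : ℕ) (μ : ι → ℕ) (p : ι → Fin 3 → ℂ)
    (ν : κ → ℕ) (q : κ → Fin 3 → ℂ) :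
    Module.finrank ℂ (gluedSections d c μ p ν q 0)
      ≤ Module.finrank ℂ ((highSections d c ν q).map (binaryPart c) ⊓
          (lowSections d (c + 1) μ p).map (binaryPart c) : Submodule ℂ Poly)
        + (Module.finrank ℂ (highSections d (c + 1) ν q)
          + Module.finrank ℂ (lowSections d c μ p)) := by
  let A : Poly →ₗ[ℂ] Poly := coeffScale fun u => 0 ^ (c - (u 0 + u 1))
  let B : Poly →ₗ[ℂ] Poly := coeffScale fun u => 0 ^ (u 0 + u 1 - c)
  have hA : ∀ F ∈ gluedSections d c μ p ν q 0, A F ∈ highSections d c ν q := by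
    rintro F ⟨-, h, -⟩
    refine ⟨h, fun u hu => ?_⟩
    rw [coeff_coeffScale, zero_pow (by omega), zero_mul]
  have hB : ∀ F ∈ gluedSections d c μ p ν q 0, B F ∈ lowSections d (c + 1) μ p := by
    rintro F ⟨-, -, h⟩
    refine ⟨h, fun u hu => ?_⟩
    rw [coeff_coeffScale, zero_pow (by omega), zero_mul]
  have hπA : ∀ F, binaryPart c (A F) = binaryPart c F := by
    intro F
    ext u
    simp only [binaryPart, A, coeff_coeffScale]
    split_ifs with h <;> simp [h]
  have hπB : ∀ F, binaryPart c (B F) = binaryPart c F := by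
    intro F
    ext u
    simp only [binaryPart, B, coeff_coeffScale]
    split_ifs with h <;> simp [h]
  have hinj : Function.Injective (A.prod B) := by
    rw [← LinearMap.ker_eq_bot, eq_bot_iff]
    intro F hF
    have hFA : A F = 0 := congrArg Prod.fst (LinearMap.mem_ker.1 hF)
    have hFB : B F = 0 := congrArg Prod.snd (LinearMap.mem_ker.1 hF)
    refine (Submodule.mem_bot ℂ).2 (MvPolynomial.ext _ _ fun u => ?_)
    have h1 := congrArg (coeff u) hFA
    have h2 := congrArg (coeff u) hFB
    rw [coeff_coeffScale, coeff_zero] at h1 h2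
    rcases le_total c (u 0 + u 1) with h | h
    · rwa [Nat.sub_eq_zero_of_le h, pow_zero, one_mul] at h1
    · rwa [Nat.sub_eq_zero_of_le h, pow_zero, one_mul] at h2
  rw [← finrank_map_add_finrank_inf_ker (binaryPart c)]
  refine add_le_add ?_ ?_
  · refine Submodule.finrank_mono ?_
    rintro _ ⟨F, hF, rfl⟩
    exact ⟨⟨A F, hA F hF, hπA F⟩, ⟨B F, hB F hF, hπB F⟩⟩
  · rw [← finrank_map_of_injective _ hinj, ← Module.finrank_prod]
    refine le_trans (Submodule.finrank_mono ?_) (LinearMap.finrank_range_le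
      ((highSections d (c + 1) ν q).subtype.prodMap (lowSections d c μ p).subtype))
    rintro _ ⟨F, ⟨hF, hπ⟩, rfl⟩
    have hπ' : binaryPart c F = 0 := hπ
    have h1 : A F ∈ highSections d (c + 1) ν q := by
      rw [← highSections_inf_ker]
      exact ⟨hA F hF, LinearMap.mem_ker.2 ((hπA F).trans hπ')⟩
    have h2 : B F ∈ lowSections d c μ p := by
      rw [← lowSections_inf_ker]
      exact ⟨hB F hF, LinearMap.mem_ker.2 ((hπB F).trans hπ')⟩
    exact ⟨(⟨A F, h1⟩, ⟨B F, h2⟩), rfl⟩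

/-- A form divisible by `Z ^ (d - c)` is determined by its quotient, which has degree `c` and the
same multiplicities off the line `Z = 0`. -/
theorem finrank_lowSections_le {ι : Type*} {d c : ℕ} (hc : c ≤ d) (μ : ι → ℕ) (p : ι → Fin 3 → ℂ)
    (hp : ∀ i, p i 2 ≠ 0) :
    Module.finrank ℂ (lowSections d (c + 1) μ p) ≤ Module.finrank ℂ (vecSections c μ p) := by
  refine le_trans (Submodule.finrank_mono ?_)
    (Submodule.finrank_map_le (LinearMap.mulLeft ℂ (X 2 ^ (d - c) : Poly)) (vecSections c μ p))
  rintro F ⟨hF, hF2⟩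
  have hdvd : (monomial (Finsupp.single 2 (d - c)) (1 : ℂ)) ∣ F := by
    rw [monomial_one_dvd_iff_modMonomial_eq_zero]
    ext u
    rw [coeff_zero]
    by_cases hu : Finsupp.single 2 (d - c) ≤ u
    · exact coeff_modMonomial_of_le _ hu
    · rw [coeff_modMonomial_of_not_le _ hu]
      by_contra hne
      have h1 := hF.1.degree_eq hne
      have h2 : ¬ c + 1 ≤ u 0 + u 1 := fun h => hne (hF2 u h)
      exact hu (Finsupp.single_le_iff.2 (by omega))
  obtain ⟨G, hG⟩ := hdvd
  rw [← X_pow_eq_monomial] at hG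
  refine ⟨G, ⟨fun u hu => ?_, fun i => ?_⟩, hG.symm⟩
  · have h1 : coeff (Finsupp.single 2 (d - c) + u) F ≠ 0 := by
      rw [hG, X_pow_eq_monomial, coeff_monomial_mul, one_mul]
      exact hu
    have h2 := hF.1.degree_eq h1
    have h3 : Finsupp.weight 1 u = u.degree := by
      rw [Finsupp.degree_eq_weight_one]
      rfl
    rw [h3, Finsupp.degree_eq_sum, Fin.sum_univ_three]
    simp at h2
    omega
  · have h1 := hF.2 i
    rwa [hG, vanishesToOrder_X_pow_mul _ (hp i)] at h1

/-- Moving the base points by `M⁻¹` corresponds to substituting `M` in the forms. -/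
theorem lowSections_inv_le {ι : Type*} (d c : ℕ) (μ : ι → ℕ) (p : ι → Fin 3 → ℂ)
    {M : Matrix (Fin 3) (Fin 3) ℂ} (hM : IsBinaryChange M) :
    lowSections d c μ (fun i => M⁻¹.mulVec (p i))
      ≤ (lowSections d c μ p).map (subst M).toLinearMap := by
  rintro F ⟨hF, hF2⟩
  refine ⟨subst M⁻¹ F, ⟨(subst_mem_vecSections hM.inv.isUnit hF.1).2 hF, fun u hu => ?_⟩,
    subst_subst_inv hM.isUnit F⟩
  have h1 : coeffScale (fun u => if u 0 + u 1 < c then 1 else 0) F = F := by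
    ext u
    rw [coeff_coeffScale]
    split_ifs with h
    · rw [one_mul]
    · rw [hF2 u (not_lt.1 h), mul_zero]
  rw [← h1, hM.inv.subst_coeffScale (fun j => if j < c then 1 else 0), coeff_coeffScale,
    if_neg (not_lt.2 hu), zero_mul]

/-- For points `p`, `q` there are points, obtained from the `p` by projective transformations and
from `q`, whose linear system is bounded by the dimensions of the four systems on the components of
the degenerate plane, as if the restrictions to the double curve were transverse. -/
theorem exists_finrank_vecSections_le_max {ι κ : Type*} {d c : ℕ}
    (μ : ι → ℕ) (p : ι → Fin 3 → ℂ) (hp : ∀ i, p i 2 ≠ 0) (ν : κ → ℕ) (q : κ → Fin 3 → ℂ) :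
    ∃ p' : ι → Fin 3 → ℂ, (∀ i, p' i 2 ≠ 0) ∧
      Module.finrank ℂ (vecSections d (Sum.elim μ ν) (Sum.elim p' q)) ≤
        max (Module.finrank ℂ (lowSections d c μ p) + Module.finrank ℂ (highSections d (c + 1) ν q))
          (Module.finrank ℂ (lowSections d (c + 1) μ p) + Module.finrank ℂ (highSections d c ν q)
            - (c + 1)) := by
  have hhigh := finrank_map_add_finrank_inf_ker (binaryPart c) (highSections d c ν q)
  have hlow := finrank_map_add_finrank_inf_ker (binaryPart c) (lowSections d (c + 1) μ p)
  rw [highSections_inf_ker] at hhigh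
  rw [lowSections_inf_ker] at hlow
  obtain ⟨M, hM, h⟩ := exists_isBinaryChange_finrank_inf_le (c := c) (e := d - c)
    ((highSections d c ν q).map (binaryPart c)) ((lowSections d (c + 1) μ p).map (binaryPart c))
    (Submodule.map_le_iff_le_comap.2 fun F hF => binaryPart_mem_binaryForms hF.1.1)
    (Submodule.map_le_iff_le_comap.2 fun F hF => binaryPart_mem_binaryForms hF.1.1)
  obtain ⟨t, ht, htle⟩ := exists_finrank_gluedSections_le d c μ (fun i => M⁻¹.mulVec (p i)) ν q
  refine ⟨fun i => (Matrix.diagonal ![t, t, 1]).mulVec (M⁻¹.mulVec (p i)), fun i => ?_, ?_⟩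
  · show (Matrix.diagonal ![t, t, 1]).mulVec (M⁻¹.mulVec (p i)) 2 ≠ 0
    rw [Matrix.mulVec_diagonal, hM.inv.apply_two]
    simpa using hp i
  have h1 := finrank_vecSections_sumElim_le d c μ (fun i => M⁻¹.mulVec (p i)) ν q ht
  have h2 := finrank_gluedSections_zero_le d c μ (fun i => M⁻¹.mulVec (p i)) ν q
  have h3 : Module.finrank ℂ (lowSections d c μ fun i => M⁻¹.mulVec (p i))
      ≤ Module.finrank ℂ (lowSections d c μ p) :=
    (Submodule.finrank_mono (lowSections_inv_le d c μ p hM)).trans (Submodule.finrank_map_le _ _)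
  have h4 : Module.finrank ℂ ((highSections d c ν q).map (binaryPart c) ⊓
          (lowSections d (c + 1) μ fun i => M⁻¹.mulVec (p i)).map (binaryPart c) :
            Submodule ℂ Poly) ≤
      Module.finrank ℂ ((highSections d c ν q).map (binaryPart c) ⊓
        ((lowSections d (c + 1) μ p).map (binaryPart c)).map (subst M).toLinearMap :
          Submodule ℂ Poly) := by
    refine Submodule.finrank_mono (inf_le_inf_left _ ?_)
    rintro _ ⟨F, hF, rfl⟩
    obtain ⟨G, hG, rfl⟩ := lowSections_inv_le d (c + 1) μ p hM hF
    exact ⟨binaryPart c G, ⟨G, hG, rfl⟩,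
      hM.subst_coeffScale (fun j => if j = c then 1 else 0) G⟩
  omega

theorem highSections_eq_vecSections {b : ℕ} (d c m : ℕ) (q : Fin b → Fin 3 → ℂ) :
    highSections d c (fun _ => m) q
      = vecSections d (quasiHomMult c b m) (Fin.cons (Pi.single 2 1) q) := by
  ext F
  constructor
  · rintro ⟨⟨h1, h2⟩, h3⟩
    exact ⟨h1, Fin.cases ((vanishesToOrder_origin_iff h1 c).2 h3) h2⟩
  · rintro ⟨h1, h2⟩
    exact ⟨⟨h1, fun i => h2 i.succ⟩, (vanishesToOrder_origin_iff h1 c).1 (h2 0)⟩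

/-- The estimate given by the degeneration of the plane into two components. -/
theorem generalRank_le_max {d c : ℕ} (hc : 0 < c) (hcd : c ≤ d) (m₀ n b m : ℕ) :
    generalRank d m₀ (n + b) m ≤
      max (generalRank (c - 1) m₀ n m + generalRank d (c + 1) b m)
        (generalRank c m₀ n m + generalRank d c b m - (c + 1)) := by
  obtain ⟨p, hp, hp1, hp2⟩ := exists_finrank_eq_generalRank_and (c - 1) c m₀ m₀ n m
  obtain ⟨w, hw, hw1, hw2⟩ := exists_finrank_eq_generalRank_and d d (c + 1) c b m
  have hw0 : ∀ i, w i ≠ 0 := fun i h => hw i (congrFun h 2)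
  obtain ⟨N, hN, hNw⟩ := exists_mulVec_eq (hw0 0) (w := Pi.single 2 1) (by simp)
  -- The first of the points `w` may be taken to be `(0, 0, 1)`.
  have hcons : (fun i => N.mulVec (w i))
      = Fin.cons (Pi.single 2 1) fun i : Fin b => N.mulVec (w i.succ) := by
    funext i
    refine Fin.cases ?_ (fun i => ?_) i
    · rw [hNw, Fin.cons_zero]
    · rw [Fin.cons_succ]
  rw [← finrank_vecSections_mulVec _ _ w hN, hcons, ← highSections_eq_vecSections] at hw1 hw2
  obtain ⟨p', hp', h⟩ := exists_finrank_vecSections_le_max (d := d) (c := c)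
    (quasiHomMult m₀ n m) p hp (fun _ => m) fun i : Fin b => N.mulVec (w i.succ)
  have hlow := finrank_lowSections_le ((Nat.sub_le c 1).trans hcd)
    (quasiHomMult m₀ n m) p hp
  rw [Nat.sub_add_cancel hc] at hlow
  have hlow' := finrank_lowSections_le hcd (quasiHomMult m₀ n m) p hp
  have h1 := generalRank_le d m₀ (n + b) m
    (Fin.cons (p' 0) (Fin.append (fun i => p' i.succ) fun i : Fin b => N.mulVec (w i.succ))) (by
      refine Fin.cases ?_ (Fin.addCases (fun i => ?_) fun i => ?_)
      · exact fun h => hp' 0 (congrFun h 2)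
      · rw [Fin.cons_succ, Fin.append_left]
        exact fun h => hp' i.succ (congrFun h 2)
      · rw [Fin.cons_succ, Fin.append_right]
        intro h
        exact hw0 i.succ (Matrix.mulVec_injective_iff_isUnit.2 hN
          (h.trans (Matrix.mulVec_zero N).symm)))
  have h2 : Module.finrank ℂ (vecSections d (quasiHomMult m₀ (n + b) m)
      (Fin.cons (p' 0) (Fin.append (fun i => p' i.succ) fun i : Fin b => N.mulVec (w i.succ))))
      ≤ Module.finrank ℂ (vecSections d (Sum.elim (quasiHomMult m₀ n m) fun _ => m)
        (Sum.elim p' fun i : Fin b => N.mulVec (w i.succ))) := by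
    refine Submodule.finrank_mono ?_
    rintro F ⟨hF, hv⟩
    refine ⟨hF, ?_⟩
    rintro (i | i)
    · refine Fin.cases (hv 0) (fun i => ?_) i
      have := hv (Fin.castAdd b i).succ
      rwa [Fin.cons_succ, Fin.append_left] at this
    · have := hv (Fin.natAdd n i).succ
      rwa [Fin.cons_succ, Fin.append_right] at this
  omega

end PlaneSystem

theorem mainTheorem4 (d m₀ n m : ℕ) :
    -- Part (a): criterion for emptiness.
    (∀ k b : ℕ, 0 < k → k < d → 0 < b → b < n →
      IsEmptySystem (d - k - 1) m₀ (n - b) m →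
      IsEmptySystem d (d - k + 1) b m →
      PlaneSystem.dim (d - k) m₀ (n - b) m + PlaneSystem.dim d (d - k) b m
        ≤ (d : ℤ) - (k : ℤ) - 1 →
      IsEmptySystem d m₀ n m ∧ NonSpecial d m₀ n m) ∧
    -- Part (a): the third hypothesis is automatic under the following conditions.
    (∀ k b : ℕ, 0 < k → k < d → 0 < b → b < n →
      virtualDim d m₀ n m ≤ -1 →
      NonSpecial (d - k) m₀ (n - b) m → -1 ≤ virtualDim (d - k) m₀ (n - b) m →
      NonSpecial d (d - k) b m → -1 ≤ virtualDim d (d - k) b m →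
      PlaneSystem.dim (d - k) m₀ (n - b) m + PlaneSystem.dim d (d - k) b m
        ≤ (d : ℤ) - (k : ℤ) - 1) ∧
    -- Part (b): criterion for non-speciality.
    (∀ k b : ℕ, 0 < k → k < d → 0 < b → b < n →
      -1 ≤ virtualDim (d - k) m₀ (n - b) m → NonSpecial (d - k) m₀ (n - b) m →
      -1 ≤ virtualDim d (d - k) b m → NonSpecial d (d - k) b m →
      PlaneSystem.dim (d - k - 1) m₀ (n - b) m + PlaneSystem.dim d (d - k + 1) b m
        ≤ virtualDim d m₀ n m - 1 →
      NonSpecial d m₀ n m ∧ -1 ≤ virtualDim d m₀ n m ∧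
        PlaneSystem.dim d m₀ n m = virtualDim d m₀ n m) ∧
    -- Part (b): the third hypothesis is automatic under the following conditions.
    (∀ k b : ℕ, 0 < k → k < d → 0 < b → b < n →
      NonSpecial (d - k - 1) m₀ (n - b) m → -1 ≤ virtualDim (d - k - 1) m₀ (n - b) m →
      NonSpecial d (d - k + 1) b m → -1 ≤ virtualDim d (d - k + 1) b m →
      PlaneSystem.dim (d - k - 1) m₀ (n - b) m + PlaneSystem.dim d (d - k + 1) b m
        ≤ virtualDim d m₀ n m - 1) := by
  -- The virtual dimensions of the four systems on the degenerate plane determine that of the plane.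
  have hv : ∀ k b, k < d → b < n →
      virtualDim (d - k) m₀ (n - b) m + virtualDim d (d - k) b m - ((d : ℤ) - k)
          = virtualDim d m₀ n m ∧
        virtualDim (d - k - 1) m₀ (n - b) m + virtualDim d (d - k + 1) b m
          = virtualDim d m₀ n m - (d - k) - 2 := by
    intro k b hk hb
    obtain ⟨c, rfl⟩ : ∃ c, d = k + c + 1 := Nat.exists_eq_add_of_lt hk
    obtain ⟨a, rfl⟩ := Nat.exists_eq_add_of_lt hb
    have e1 : k + c + 1 - k = c + 1 := by omega
    have e2 : b + a + 1 - b = a + 1 := by omega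
    rw [e1, e2, Nat.add_sub_cancel]
    have h1 := two_mul_virtualDim (k + c + 1) m₀ (b + a + 1) m
    have h2 := two_mul_virtualDim (c + 1) m₀ (a + 1) m
    have h3 := two_mul_virtualDim (k + c + 1) (c + 1) b m
    have h4 := two_mul_virtualDim c m₀ (a + 1) m
    have h5 := two_mul_virtualDim (k + c + 1) (c + 1 + 1) b m
    push_cast at *
    constructor <;> linarith
  have hle : ∀ k b, k < d → b < n →
      (generalRank d m₀ n m : ℤ) ≤
        max ((generalRank (d - k - 1) m₀ (n - b) m : ℤ) + generalRank d (d - k + 1) b m)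
          (max 0 (generalRank (d - k) m₀ (n - b) m + generalRank d (d - k) b m
            - (d - k + 1))) := by
    intro k b hk hb
    have h := generalRank_le_max (Nat.sub_pos_of_lt hk) (Nat.sub_le d k) m₀ (n - b) b m
    rw [Nat.sub_add_cancel hb.le] at h
    omega
  have hlb := virtualDim_le_dim d m₀ n m
  simp only [IsEmptySystem, NonSpecial, expectedDim, dim_eq_generalRank_sub_one] at *
  refine ⟨?_, ?_, ?_, ?_⟩ <;> intro k b hk0 hk hb0 hb <;> have h1 := hv k b hk hb <;>
    have h2 := hle k b hk hb <;> intros <;> omega
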